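/- **Setting.** Consider the discrete-time stochastic system $x_{t+1}=f(x_t,u_t,w_t)$ with states in $\mathbb R^n$, controls in a nonempty convex Borel set $\mathbb U\subseteq\mathbb R^m$, and independent disturbances $w_t$ in $\mathbb R^l$, $w_t$ having law $\nu_t$. Let $T\in\mathbb N$, $\alpha\in(0,1)$, $\delta\ge 0$, let $A\subset\mathbb R^n$ be nonempty, convex and compact with $\mathrm{dist}(x,A)=\inf_{y\in A}\|x-y\|$, and let $f$, the stage cost $r:\mathbb R^n\times\mathbb R^m\to\mathbb R$ and the terminal cost $q:\mathbb R^n\to\mathbb R$ be Borel measurable. For the system started at stage $t$ in state $x_t=x$, an admissible strategy $\pi=(\pi_t,\dots,\pi_{T-1})\in\Pi$ consists of stochastic kernels $\pi_s$ from the histories $h_s=(x_t,w_t,\dots,x_{s-1},w_{s-1},x_s)$ to control values, with $\pi_s(\mathbb U\mid h_s)=1$ for every $h_s$; given the past, $u_s$ is drawn from $\pi_s(\cdot\mid h_s)$ and $w_s$ is independent of the past and of $u_s$. Let $\mathcal F_{s-1}$ be the $\sigma$-algebra generated by the information available when $u_s$ has been chosen and $w_s$ has not yet been realized, that is, by $x_t,u_t,w_t,\dots,x_{s-1},u_{s-1},w_{s-1},x_s,u_s$.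 For a nonnegative random variable $X$, $$\mathrm{CVaR}_\alpha[X\mid\mathcal F_{s-1}]:=\min_{Z\in\mathcal L_2(\Omega,\mathcal F_{s-1},\mathbb P)} Z+\mathbb E\Big[\frac{(X-Z)^+}{1-\alpha}\,\Big|\,\mathcal F_{s-1}\Big],$$ the minimum being understood in the almost sure order (essential infimum). The value function is $$v_t(x):=\inf_{\pi\in\Pi}\ \mathbb E^\pi\Big[\sum_{s=t}^{T-1}r(x_s,u_s)+q(x_T)\,\Big|\,x_t=x\Big]\quad\text{s.t.}\quad \mathrm{CVaR}^\pi_\alpha[\mathrm{dist}(x_{s+1},A)\mid\mathcal F_{s-1}]\le\delta\ \text{ a.s.},\quad s=t,\dots,T-1,$$ with values in $[-\infty,+\infty]$ and $\inf\emptyset=+\infty$. Here $\mathbb E[g]=\mathbb E[g^+]-\mathbb E[g^-]$, which is read as $+\infty$ whenever $\mathbb E[g^+]=+\infty$. Assume that for all $t\le T$ and $x$ the expected cost of every strategy that satisfies the risk constraints is well defined in $[-\infty,+\infty]$, that is, the positive or the negative part of the cost has finite expectation (for instance, $r$ and $q$ are bounded below). **Theorem 1 (Bellman equation I).** $v_T(x)=q(x)$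 for all $x\in\mathbb R^n$. For every $t\in\{0,\dots,T-1\}$ and $x\in\mathbb R^n$, the function $w\mapsto v_{t+1}(f(x,u,w))$ is $\nu_t$-almost everywhere equal to a Borel function for each $u\in\mathbb U$, and $$v_t(x)=\inf_{u\in\mathbb U,\ z\in\mathbb R}\ r(x,u)+\mathbb E\big[v_{t+1}(f(x,u,w_t))\big]\quad\text{s.t.}\quad \mathbb E\Big[z+\frac{(\mathrm{dist}(f(x,u,w_t),A)-z)^+}{1-\alpha}\Big]\le\delta .$$ -/

import Mathlib

open MeasureTheory ProbabilityTheory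
open scoped ENNReal

namespace SafetyControl

/-- Euclidean space `ℝᵈ` (Euclidean norm, Borel σ-algebra). -/
abbrev E (d : ℕ) : Type := EuclideanSpace ℝ (Fin d)

/-! ### Extended expectation -/

/-- The expectation `E[g⁺] - E[g⁻]` of an extended real-valued function, with the convention of
minimization problems that it is `+∞` as soon as `E[g⁺] = +∞`. -/
noncomputable def expectation {Ω : Type*} [MeasurableSpace Ω] (μ : Measure Ω) (g : Ω → EReal) :
    EReal :=
  open Classical in
  if ∫⁻ ω, (g ω).toENNReal ∂μ = ⊤ then ⊤
  else ((∫⁻ ω, (g ω).toENNReal ∂μ : ℝ≥0∞) : EReal) - ((∫⁻ ω, (-g ω).toENNReal ∂μ : ℝ≥0∞) : EReal)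

/-! ### Conditional value-at-risk -/

/-- The random variable `Z + E[(X - Z)⁺ / (1 - α) | 𝒢]`. The conditional expectation is that of a
nonnegative random variable, hence takes values in `[0, ∞]`. -/
noncomputable def cvarObjective {Ω : Type*} (𝒢 : MeasurableSpace Ω) {mΩ : MeasurableSpace Ω}
    (μ : Measure[mΩ] Ω) (α : ℝ) (X Z : Ω → ℝ) (ω : Ω) : EReal :=
  (Z ω : EReal) +
    ((condLExp 𝒢 μ (fun ω' => ENNReal.ofReal (max (X ω' - Z ω') 0 / (1 - α))) ω : ℝ≥0∞) : EReal)

/-- `Y` is (a version of) the conditional value-at-risk `CVaR_α[X | 𝒢]`: the minimum, in the sense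
of the almost sure order (that is, the essential infimum), of `Z + E[(X - Z)⁺ / (1 - α) | 𝒢]` over
the square-integrable `𝒢`-measurable random variables `Z`. -/
structure IsCondCVaR {Ω : Type*} (𝒢 : MeasurableSpace Ω) {mΩ : MeasurableSpace Ω}
    (μ : Measure[mΩ] Ω) (α : ℝ) (X : Ω → ℝ) (Y : Ω → EReal) : Prop where
  measurable : Measurable[𝒢] Y
  le_objective : ∀ Z : Ω → ℝ, Measurable[𝒢] Z → MemLp Z 2 μ →
    ∀ᵐ ω ∂μ, Y ω ≤ cvarObjective 𝒢 μ α X Z ω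
  greatest : ∀ Y' : Ω → EReal, Measurable[𝒢] Y' →
    (∀ Z : Ω → ℝ, Measurable[𝒢] Z → MemLp Z 2 μ →
      ∀ᵐ ω ∂μ, Y' ω ≤ cvarObjective 𝒢 μ α X Z ω) →
    ∀ᵐ ω ∂μ, Y' ω ≤ Y ω

/-- The risk constraint `CVaR_α[X | 𝒢] ≤ δ` almost surely. -/
def CondCVaRLE {Ω : Type*} (𝒢 : MeasurableSpace Ω) {mΩ : MeasurableSpace Ω}
    (μ : Measure[mΩ] Ω) (α : ℝ) (X : Ω → ℝ) (δ : ℝ) : Prop :=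
  ∃ Y : Ω → EReal, IsCondCVaR 𝒢 μ α X Y ∧ ∀ᵐ ω ∂μ, Y ω ≤ (δ : EReal)

/-! ### The controlled system -/

/-- The data of a safety risk-constrained stochastic optimal control problem for the system
`x_{t+1} = f(x_t, u_t, w_t)` on `ℝⁿ` with controls in `𝕌 ⊆ ℝᵐ` and independent disturbances
`w_t` in `ℝˡ`. -/
structure Problem (n m l : ℕ) where
  /-- the dynamics -/
  f : E n → E m → E l → E n
  measurable_f : Measurable fun p : E n × E m × E l => f p.1 p.2.1 p.2.2
  /-- the set of control values -/
  U : Set (E m)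
  convex_U : Convex ℝ U
  nonempty_U : U.Nonempty
  measurableSet_U : MeasurableSet U
  /-- the law of the disturbance `w_t` -/
  ν : ℕ → Measure (E l)
  isProbabilityMeasure_ν : ∀ t, IsProbabilityMeasure (ν t)
  /-- the desired set for safety -/
  A : Set (E n)
  nonempty_A : A.Nonempty
  convex_A : Convex ℝ A
  isCompact_A : IsCompact A
  /-- the stage-wise cost -/
  r : E n → E m → ℝ
  measurable_r : Measurable fun p : E n × E m => r p.1 p.2
  /-- the terminal cost -/
  q : E n → ℝ
  measurable_q : Measurable q
  /-- the horizon -/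
  T : ℕ
  /-- the probability level of CVaR -/
  α : ℝ
  zero_lt_α : 0 < α
  α_lt_one : α < 1
  /-- the risk tolerance -/
  δ : ℝ
  zero_le_δ : 0 ≤ δ

/-- Histories `(x_t, w_t, …, x_{t+k-1}, w_{t+k-1}, x_{t+k})`, `k` steps after the initial
stage `t`. -/
abbrev History (n l k : ℕ) : Type := (Fin k → E n × E l) × E n

/-- Paths `(x_t, u_t, w_t, …, x_{t+k-1}, u_{t+k-1}, w_{t+k-1}, x_{t+k})`, `k` steps after the
initial stage `t`. -/
abbrev Path (n m l k : ℕ) : Type := (Fin k → E n × E m × E l) × E n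

namespace Path

variable {n m l k : ℕ}

/-- The history part of a path (the controls are dropped). -/
def history (ω : Path n m l k) : History n l k :=
  (fun i => ((ω.1 i).1, (ω.1 i).2.2), ω.2)

theorem measurable_history : Measurable (history : Path n m l k → History n l k) := by
  unfold history
  fun_prop

/-- The states `x_t, …, x_{t+k}` along a path. -/
def state (ω : Path n m l k) : Fin (k + 1) → E n := Fin.snoc (fun i => (ω.1 i).1) ω.2

/-- The controls `u_t, …, u_{t+k-1}` along a path. -/
def control (ω : Path n m l k) (i : Fin k) : E m := (ω.1 i).2.1

/-- Everything known at stage `t + i` after the control has been chosen and before the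
disturbance is realized: `(x_t, u_t, w_t, …, x_{t+i-1}, u_{t+i-1}, w_{t+i-1})`, `x_{t+i}`
and `u_{t+i}`. -/
def info (i : Fin k) (ω : Path n m l k) : (Fin (i : ℕ) → E n × E m × E l) × E n × E m :=
  (fun j => ω.1 (Fin.castLE i.isLt.le j), (ω.1 i).1, (ω.1 i).2.1)

/-- The σ-algebra `𝓕_{t+i-1}` generated by the information on which the risk at stage `t + i + 1`
is assessed. -/
@[reducible]
def infoSigma (i : Fin k) : MeasurableSpace (Path n m l k) :=
  MeasurableSpace.comap (info i) inferInstance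

end Path

namespace Problem

variable {n m l : ℕ} (P : Problem n m l)

/-- Admissible strategies: a stochastic kernel from histories to control values at every stage,
counted from the initial stage. -/
structure Strategy where
  /-- the stochastic kernel used `k` steps after the initial stage -/
  kernel : (k : ℕ) → Kernel (History n l k) (E m)
  isMarkovKernel : ∀ k, IsMarkovKernel (kernel k)
  mem_U : ∀ k h, kernel k h P.U = 1

variable {P}

/-- The law of the path over the first `k` steps of the system started at stage `t` in state `x`
and controlled by `π`: given the path so far, `u_{t+k}` is drawn from `π` evaluated at the
history, `w_{t+k}` is drawn independently from its law, and the state moves by `f`. -/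
noncomputable def pathLaw (π : P.Strategy) (t : ℕ) (x : E n) :
    (k : ℕ) → Measure (Path n m l k)
  | 0 => Measure.dirac (Fin.elim0, x)
  | k + 1 =>
    ((pathLaw π t x k) ⊗ₘ
      (((π.kernel k).comap Path.history Path.measurable_history) ×ₖ
        Kernel.const _ (P.ν (t + k)))).map
      fun p => (Fin.snoc p.1.1 (p.1.2, p.2.1, p.2.2), P.f p.1.2 p.2.1 p.2.2)

variable (P)

/-- The cost `∑ r(x_s, u_s) + q(x_T)` of a path. -/
def cost {k : ℕ} (ω : Path n m l k) : ℝ :=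
  ∑ i : Fin k, P.r (ω.state i.castSucc) (ω.control i) + P.q (ω.state (Fin.last k))

variable {P}

/-- The strategy satisfies the risk constraints
`CVaR_α[dist(x_{s+1}, A) | 𝓕_{s-1}] ≤ δ` for `s = t, …, T - 1`, when `x_t = x`. -/
def Feasible (π : P.Strategy) (t : ℕ) (x : E n) : Prop :=
  ∀ i : Fin (P.T - t),
    CondCVaRLE (Path.infoSigma i) (pathLaw π t x (P.T - t)) P.α
      (fun ω => Metric.infDist (ω.state i.succ) P.A) P.δ

/-- The expected cost-to-go of a strategy from stage `t` and state `x`. -/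
noncomputable def expectedCost (π : P.Strategy) (t : ℕ) (x : E n) : EReal :=
  expectation (pathLaw π t x (P.T - t)) fun ω => ((P.cost ω : ℝ) : EReal)

variable (P)

/-- The value function: the infimum of the expected cost-to-go over the admissible strategies that
satisfy the risk constraints (`+∞` if there is none). -/
noncomputable def value (t : ℕ) (x : E n) : EReal :=
  ⨅ (π : P.Strategy) (_ : Feasible π t x), expectedCost π t x

/-- The expected cost-to-go of every strategy that satisfies the risk constraints is well defined
in `[-∞, ∞]`: the positive or the negative part of the cost has a finite expectation. -/
def CostsWellDefined : Prop :=
  ∀ t ≤ P.T, ∀ (x : E n) (π : P.Strategy), Feasible π t x →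
    ∫⁻ ω, ENNReal.ofReal (P.cost ω) ∂(pathLaw π t x (P.T - t)) ≠ ⊤ ∨
    ∫⁻ ω, ENNReal.ofReal (-P.cost ω) ∂(pathLaw π t x (P.T - t)) ≠ ⊤

end Problem

end SafetyControl

/-!
The risk constraint at a stage involves only the law of the next state given the current
information, which is the law of `f(x, u, w)` with `w` distributed according to the disturbance
law. So the conditional expectation in the definition of the conditional value-at-risk is an
integral over `w`, the essential infimum over the levels `Z` is the pointwise infimum over rational
levels, and the constraint says that almost surely the pair `(x, u)` of state and control satisfies
`stageRisk t x u ≤ δ`, a Borel condition (`condCVaRLE_iff`). The infimum over the levels is attained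
(`cvar_le_coe_iff`), which gives the constraint of the Bellman equation its form with an explicit
`z`.

The law of the path can be split after the first step (`lintegral_pathLaw_succ'`): after `(x, u, w)`
the system runs from `f(x, u, w)` under the continuation `π.tail x w`. Each continuation costs at
least the value of its initial state. Averaging over `w`, and then over the possibly random first
control, gives that the value is at least the right hand side (`le_expectedCost_of_forall_le`).

The converse inequality glues a first control to near-optimal continuations, which have to be chosen
measurably. For this, all strategies are parametrized, up to their path laws, by the standard Borel
space of sequences of functions `ℚ → ℝ`: every probability measure on a standard Borel space is
coded by a distribution function on `ℚ`, and the disintegration of the coded joint law of history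
and control is a control law that depends measurably on the code (`exists_codedStrategy`). Safety
and expected cost are Borel in the code and the initial state. Hence the sublevel sets of the value
function are projections of Borel sets, and an almost sure Jankov–von Neumann theorem
(`exists_measurable_uniformization`) shows that the value function is universally measurable and
that one strategy is near-optimal from almost every initial state
(`exists_strategy_expectedCost_lt`). Strategies see their initial state, so the choice of the code
can be made part of a single strategy. The uniformization theorem itself follows from Choquet's
argument that a continuous image of Baire space is exhausted in measure by images of compact sets.

The expectation is `+∞` as soon as the positive part has infinite integral, and the tower property
may fail for costs whose positive and negative parts both have infinite integral. The hypothesis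
that the costs of safe strategies are well defined excludes this for the glued strategy
(`expectation_le_expectation_of_mixture`).
-/

namespace SafetyControl

/-! ### Measurable uniformization -/

/-- A continuous injection of Baire space into the real line, through the ternary Cantor set. -/
theorem exists_continuous_injective_baire_real :
    ∃ φ : (ℕ → ℕ) → ℝ, Continuous φ ∧ Function.Injective φ := by
  let e : (ℕ → ℕ) → (ℕ → Bool) := fun y k => decide (y k.unpair.1 = k.unpair.2)
  have he : Continuous e := continuous_pi fun k =>
    (continuous_of_discreteTopology (f := fun j : ℕ => decide (j = k.unpair.2))).comp
      (continuous_apply k.unpair.1)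
  have hinj : Function.Injective e := by
    intro y z hyz
    funext i
    have h := congrFun hyz (Nat.pair i (z i))
    simpa [e] using h
  exact ⟨fun y => (cantorSetHomeomorphNatToBool.symm (e y) : ℝ),
    continuous_subtype_val.comp (cantorSetHomeomorphNatToBool.symm.continuous.comp he),
    Subtype.val_injective.comp (cantorSetHomeomorphNatToBool.symm.injective.comp hinj)⟩

/-- A continuous map on a compact subset of Baire space has a Borel right inverse: take the
preimage that is least for a continuous injection into `ℝ`. The sublevel sets of that minimum are
images of compact sets. -/
theorem exists_measurable_rightInverse_of_isCompact {X : Type*} [TopologicalSpace X] [T2Space X]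
    [MeasurableSpace X] [OpensMeasurableSpace X] {g : (ℕ → ℕ) → X} (hg : Continuous g)
    {K : Set (ℕ → ℕ)} (hK : IsCompact K) :
    ∃ σ : X → (ℕ → ℕ), Measurable σ ∧ ∀ x ∈ g '' K, g (σ x) = x := by
  obtain ⟨φ, hφc, hφi⟩ := exists_continuous_injective_baire_real
  have hφ : MeasurableEmbedding φ := hφc.measurableEmbedding hφi
  let m : X → ℝ := fun x => sInf (φ '' (K ∩ g ⁻¹' {x}))
  have hcomp : ∀ x, IsCompact (K ∩ g ⁻¹' {x}) := fun x =>
    hK.inter_right (isClosed_singleton.preimage hg)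
  have hmem : ∀ x ∈ g '' K, ∃ y ∈ K, g y = x ∧ φ y = m x := by
    rintro x ⟨y, hy, rfl⟩
    obtain ⟨z, ⟨hzK, hz⟩, hzm⟩ :=
      ((hcomp (g y)).image hφc).sInf_mem ⟨φ y, y, ⟨hy, rfl⟩, rfl⟩
    exact ⟨z, hzK, hz, hzm⟩
  have hm : Measurable m := by
    refine measurable_of_Iic fun a => ?_
    have himg : MeasurableSet (g '' (K ∩ φ ⁻¹' Set.Iic a)) :=
      ((hK.inter_right (isClosed_Iic.preimage hφc)).image hg).isClosed.measurableSet
    have hgK : MeasurableSet (g '' K) := (hK.image hg).isClosed.measurableSet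
    have : m ⁻¹' Set.Iic a =
        g '' (K ∩ φ ⁻¹' Set.Iic a) ∪ ((g '' K)ᶜ ∩ {_x | (0 : ℝ) ≤ a}) := by
      ext x
      by_cases hx : x ∈ g '' K
      · simp only [Set.mem_preimage, Set.mem_Iic, Set.mem_union, Set.mem_inter_iff,
          Set.mem_compl_iff, hx, not_true_eq_false, false_and, or_false]
        constructor
        · intro h
          obtain ⟨y, hy, hyx, hym⟩ := hmem x hx
          exact ⟨y, ⟨hy, by simpa [hym] using h⟩, hyx⟩
        · rintro ⟨y, ⟨hy, hya⟩, hyx⟩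
          exact (csInf_le ((hcomp x).image hφc).bddBelow ⟨y, ⟨hy, hyx⟩, rfl⟩).trans hya
      · have hempty : K ∩ g ⁻¹' {x} = ∅ := by
          ext y
          simp only [Set.mem_inter_iff, Set.mem_preimage, Set.mem_singleton_iff,
            Set.mem_empty_iff_false, iff_false, not_and]
          exact fun hy hyx => hx ⟨y, hy, hyx⟩
        have hx' : x ∉ g '' (K ∩ φ ⁻¹' Set.Iic a) :=
          fun h => hx (Set.image_mono Set.inter_subset_left h)
        simp only [Set.mem_preimage, Set.mem_Iic, Set.mem_union, Set.mem_inter_iff,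
          Set.mem_compl_iff, hx, hx', not_false_eq_true, true_and, false_or, Set.mem_ofPred_eq]
        simp [m, hempty]
    rw [this]
    exact himg.union (hgK.compl.inter (MeasurableSet.const _))
  refine ⟨fun x => hφ.invFun (m x), hφ.measurable_invFun.comp hm, fun x hx => ?_⟩
  obtain ⟨y, -, hyx, hym⟩ := hmem x hx
  simp only [← hym, hφ.leftInverse_invFun y, hyx]

/-- Inner approximation (Choquet): the continuous image of Baire space is exhausted in measure by
images of compact sets. The coordinates are bounded one after the other, at no essential cost in
measure; the compact set of all sequences obeying the bounds has the required image by outer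
regularity. -/
theorem exists_isCompact_le_measure_image {X : Type*} [TopologicalSpace X] [PolishSpace X]
    [MeasurableSpace X] [BorelSpace X] (μ : Measure X) [IsFiniteMeasure μ]
    {g : (ℕ → ℕ) → X} (hg : Continuous g) {η : ℝ≥0∞} (hη : η < μ (Set.range g)) :
    ∃ K, IsCompact K ∧ η ≤ μ (g '' K) := by
  have step : ∀ (S : Set (ℕ → ℕ)) (k : ℕ), η < μ (g '' S) →
      ∃ n, η < μ (g '' (S ∩ {y | y k ≤ n})) := by
    intro S k hS
    have hmono : Monotone fun n => g '' (S ∩ {y | y k ≤ n}) := fun a b hab =>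
      Set.image_mono (Set.inter_subset_inter_right _ fun y (hy : y k ≤ a) => hy.trans hab)
    have hU : g '' S = ⋃ n, g '' (S ∩ {y | y k ≤ n}) := by
      rw [← Set.image_iUnion, ← Set.inter_iUnion]
      congr 1
      ext y
      simp only [Set.mem_inter_iff, Set.mem_iUnion, Set.mem_ofPred_eq]
      exact ⟨fun h => ⟨h, y k, le_rfl⟩, fun h => h.1⟩
    rw [hU, hmono.measure_iUnion] at hS
    exact lt_iSup_iff.1 hS
  choose nx hnx using step
  let S : ℕ → {S : Set (ℕ → ℕ) // η < μ (g '' S)} := fun k =>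
    Nat.rec ⟨Set.univ, by simpa [Set.image_univ] using hη⟩
      (fun k S => ⟨S.1 ∩ {y | y k ≤ nx S.1 k S.2}, hnx S.1 k S.2⟩) k
  let N : ℕ → ℕ := fun k => nx (S k).1 k (S k).2
  have hS : ∀ k, (S k).1 = {y | ∀ i < k, y i ≤ N i} := by
    intro k
    induction k with
    | zero => ext y; simp [S]
    | succ k ih =>
      have : (S (k + 1)).1 = (S k).1 ∩ {y | y k ≤ N k} := rfl
      rw [this, ih]
      ext y
      simp only [Set.mem_inter_iff, Set.mem_ofPred_eq, Order.lt_add_one_iff]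
      exact ⟨fun h i hi => (hi.lt_or_eq).elim (h.1 i) (fun e => e ▸ h.2),
        fun h => ⟨fun i hi => h i hi.le, h k le_rfl⟩⟩
  let K : Set (ℕ → ℕ) := Set.univ.pi fun i => Set.Iic (N i)
  have hK : IsCompact K := isCompact_univ_pi fun i => (Set.finite_Iic (N i)).isCompact
  refine ⟨K, hK, ?_⟩
  rw [(g '' K).measure_eq_iInf_isOpen]
  refine le_iInf₂ fun V hV => le_iInf fun hVo => ?_
  let _ := PiNat.metricSpaceNatNat
  obtain ⟨d, hd, hthick⟩ := hK.exists_thickening_subset_open (hVo.preimage hg)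
    (Set.image_subset_iff.1 hV)
  obtain ⟨k, hk⟩ := exists_pow_lt_of_lt_one hd (by norm_num : (1 / 2 : ℝ) < 1)
  have hsub : (S k).1 ⊆ g ⁻¹' V := by
    rw [hS k]
    intro y hy
    refine hthick (Metric.mem_thickening_iff.2 ⟨fun i => min (y i) (N i), ?_, ?_⟩)
    · exact fun i _ => Set.mem_Iic.2 (min_le_right _ _)
    · refine lt_of_le_of_lt (PiNat.mem_cylinder_iff_dist_le.1 ?_) hk
      intro i hi
      exact (min_eq_left (hy i hi)).symm
  exact (S k).2.le.trans (measure_mono (Set.image_subset_iff.2 hsub))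

/-- Almost sure form of the Jankov–von Neumann uniformization theorem: a Borel subset `B` of a
product of standard Borel spaces is uniformized, above almost every point of its projection, by a
Borel function. -/
theorem exists_measurable_uniformization {X Y : Type*} [MeasurableSpace X] [StandardBorelSpace X]
    [MeasurableSpace Y] [StandardBorelSpace Y] [Nonempty Y] (μ : Measure X) [IsFiniteMeasure μ]
    {B : Set (X × Y)} (hB : MeasurableSet B) :
    ∃ s : X → Y, Measurable s ∧ ∀ᵐ x ∂μ, (∃ y, (x, y) ∈ B) → (x, s x) ∈ B := by
  let _ := upgradeStandardBorel X
  let _ := upgradeStandardBorel Y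
  have hBa := hB.analyticSet
  rw [AnalyticSet] at hBa
  rcases hBa with rfl | ⟨F, hF, hFB⟩
  · exact ⟨fun _ => Classical.arbitrary Y, measurable_const, by simp⟩
  let g : (ℕ → ℕ) → X := fun y => (F y).1
  have hg : Continuous g := continuous_fst.comp hF
  have hrange : ∀ x, (∃ y, (x, y) ∈ B) ↔ x ∈ Set.range g := by
    intro x
    rw [← hFB]
    constructor
    · rintro ⟨y, z, hz⟩
      exact ⟨z, by simp [g, hz]⟩
    · rintro ⟨z, rfl⟩
      exact ⟨(F z).2, z, rfl⟩
  -- compact sets whose images exhaust the projection of `B`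
  have hKex : ∀ j : ℕ, ∃ K, IsCompact K ∧ μ (Set.range g) ≤ μ (g '' K) + (j + 1 : ℝ≥0∞)⁻¹ := by
    intro j
    by_cases h0 : μ (Set.range g) = 0
    · exact ⟨∅, isCompact_empty, by simp [h0]⟩
    · obtain ⟨K, hK, hle⟩ := exists_isCompact_le_measure_image μ hg
        (ENNReal.sub_lt_self (measure_ne_top μ _) h0
          (ENNReal.inv_ne_zero.2 (by finiteness : (j + 1 : ℝ≥0∞) ≠ ⊤)))
      exact ⟨K, hK, tsub_le_iff_right.1 hle⟩
  choose K hK hKμ using hKex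
  choose σ hσ hσg using fun j => exists_measurable_rightInverse_of_isCompact hg (hK j)
  have hKm : ∀ j, MeasurableSet (g '' K j) := fun j => ((hK j).image hg).isClosed.measurableSet
  classical
  let ι : X → ℕ := fun x => if h : ∃ j, x ∈ g '' K j then Nat.find h else 0
  have hι : Measurable ι := by
    refine measurable_to_countable' fun n => ?_
    have : ι ⁻¹' {n} = (g '' K n ∩ ⋂ i : ℕ, ⋂ _ : i < n, (g '' K i)ᶜ) ∪
        ((⋃ j, g '' K j)ᶜ ∩ {_x | 0 = n}) := by
      ext x
      by_cases h : ∃ j, x ∈ g '' K j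
      · have h' : x ∈ ⋃ j, g '' K j := Set.mem_iUnion.2 h
        simp only [ι, Set.mem_preimage, h, dite_true, Set.mem_singleton_iff, Nat.find_eq_iff,
          Set.mem_union, Set.mem_inter_iff, Set.mem_iInter, Set.mem_compl_iff, h',
          not_true_eq_false, false_and, or_false]
      · have h' : x ∉ ⋃ j, g '' K j := fun hx => h (Set.mem_iUnion.1 hx)
        have h'' : x ∉ g '' K n := fun hx => h ⟨n, hx⟩
        simp only [ι, Set.mem_preimage, h, dite_false, Set.mem_singleton_iff, Set.mem_union,
          Set.mem_inter_iff, h'', false_and, false_or, Set.mem_compl_iff, h', not_false_eq_true,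
          true_and, Set.mem_ofPred_eq]
    rw [this]
    exact ((hKm n).inter (MeasurableSet.iInter fun i => MeasurableSet.iInter fun _ =>
      (hKm i).compl)).union ((MeasurableSet.iUnion hKm).compl.inter (MeasurableSet.const _))
  refine ⟨fun x => (F (σ (ι x) x)).2, ?_, ?_⟩
  · have h2 : Measurable fun p : X × ℕ => σ p.2 p.1 := measurable_from_prod_countable_left hσ
    exact (measurable_snd.comp hF.measurable).comp (h2.comp (measurable_id.prodMk hι))
  · have hnull : μ (Set.range g \ ⋃ j, g '' K j) = 0 := by
      refine le_antisymm (ENNReal.le_of_forall_pos_le_add fun ε hε _ => ?_) zero_le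
      obtain ⟨j, hj⟩ := ENNReal.exists_inv_nat_lt (ENNReal.coe_pos.2 hε).ne'
      calc μ (Set.range g \ ⋃ j, g '' K j)
          ≤ μ (Set.range g \ g '' K j) :=
            measure_mono (Set.sdiff_subset_sdiff_right (Set.subset_iUnion (fun j => g '' K j) j))
        _ = μ (Set.range g) - μ (g '' K j) :=
            measure_sdiff (Set.image_subset_range _ _) (hKm j).nullMeasurableSet
              (measure_ne_top μ _)
        _ ≤ (j + 1 : ℝ≥0∞)⁻¹ := tsub_le_iff_left.2 (hKμ j)
        _ ≤ (j : ℝ≥0∞)⁻¹ := ENNReal.inv_le_inv.2 le_self_add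
        _ ≤ 0 + ε := by simpa using hj.le
    filter_upwards [measure_eq_zero_iff_ae_notMem.1 hnull] with x hx hxB
    have hxg := (hrange x).1 hxB
    have hex : ∃ j, x ∈ g '' K j := by
      by_contra h
      exact hx ⟨hxg, fun h' => h (Set.mem_iUnion.1 h')⟩
    have hmem : x ∈ g '' K (ι x) := by
      simp only [ι, hex, dite_true]
      exact Nat.find_spec hex
    have hgx : (F (σ (ι x) x)).1 = x := hσg (ι x) x hmem
    rw [← hFB]
    exact ⟨σ (ι x) x, Prod.ext hgx rfl⟩

/-- Projections of Borel sets are universally measurable. -/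
theorem nullMeasurableSet_projection {X Y : Type*} [MeasurableSpace X] [StandardBorelSpace X]
    [MeasurableSpace Y] [StandardBorelSpace Y] (μ : Measure X) [IsFiniteMeasure μ]
    {B : Set (X × Y)} (hB : MeasurableSet B) : NullMeasurableSet {x | ∃ y, (x, y) ∈ B} μ := by
  rcases isEmpty_or_nonempty Y with hY | hY
  · simp
  obtain ⟨s, hs, hsB⟩ := exists_measurable_uniformization μ hB
  refine ⟨{x | (x, s x) ∈ B}, (measurable_id.prodMk hs) hB, ?_⟩
  filter_upwards [hsB] with x hx
  exact propext ⟨hx, fun h => ⟨s x, h⟩⟩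

/-! ### The law of the path -/

namespace Path

variable {n m l k : ℕ}

@[simp]
theorem state_castSucc (ω : Path n m l k) (i : Fin k) : ω.state i.castSucc = (ω.1 i).1 := by
  simp [state]

@[simp]
theorem state_last (ω : Path n m l k) : ω.state (Fin.last k) = ω.2 := by
  simp [state]

/-- The path that starts with state `x`, control `u` and disturbance `w` and goes on as `ω`. -/
def prepend (x : E n) (u : E m) (w : E l) (ω : Path n m l k) : Path n m l (k + 1) :=
  (Fin.cons (x, u, w) ω.1, ω.2)

theorem measurable_prepend :
    Measurable fun p : (E n × E m × E l) × Path n m l k =>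
      prepend p.1.1 p.1.2.1 p.1.2.2 p.2 := by
  refine Measurable.prodMk (measurable_pi_lambda _ fun i => ?_) (by fun_prop)
  refine Fin.cases ?_ (fun j => ?_) i
  · simp only [Fin.cons_zero]; fun_prop
  · simp only [Fin.cons_succ]; fun_prop

theorem measurable_prepend_right (x : E n) (u : E m) (w : E l) :
    Measurable (prepend x u w : Path n m l k → Path n m l (k + 1)) :=
  measurable_prepend.comp (measurable_prodMk_left (x := (x, u, w)))

theorem measurable_state (i : Fin (k + 1)) : Measurable fun ω : Path n m l k => ω.state i := by
  refine Fin.lastCases ?_ (fun j => ?_) i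
  · simp only [state_last]; fun_prop
  · simp only [state_castSucc]; fun_prop

theorem measurable_info (i : Fin k) : Measurable (info i : Path n m l k → _) := by
  unfold info
  fun_prop

theorem infoSigma_le (i : Fin k) :
    (infoSigma i : MeasurableSpace (Path n m l k)) ≤ Prod.instMeasurableSpace :=
  (measurable_info i).comap_le

end Path

namespace History

variable {n l k : ℕ}

/-- The history that starts with state `x` and disturbance `w` and goes on as `h`. -/
def prepend (x : E n) (w : E l) (h : History n l k) : History n l (k + 1) :=
  (Fin.cons (x, w) h.1, h.2)

theorem measurable_prepend :
    Measurable fun p : (E n × E l) × History n l k => prepend p.1.1 p.1.2 p.2 := by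
  refine Measurable.prodMk (measurable_pi_lambda _ fun i => ?_) (by fun_prop)
  refine Fin.cases ?_ (fun j => ?_) i
  · simp only [Fin.cons_zero]; fun_prop
  · simp only [Fin.cons_succ]; fun_prop

theorem measurable_prepend_right (x : E n) (w : E l) :
    Measurable (prepend x w : History n l k → History n l (k + 1)) :=
  measurable_prepend.comp (measurable_prodMk_left (x := (x, w)))

/-- The initial state of a history. -/
def init : {k : ℕ} → History n l k → E n
  | 0, h => h.2
  | _ + 1, h => (h.1 0).1

theorem measurable_init : {k : ℕ} → Measurable (init : History n l k → E n)
  | 0 => measurable_snd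
  | k + 1 => by
    change Measurable fun h : History n l (k + 1) => (h.1 0).1
    fun_prop

end History

theorem Path.history_prepend {n m l k : ℕ} (x : E n) (u : E m) (w : E l) (ω : Path n m l k) :
    (ω.prepend x u w).history = ω.history.prepend x w := by
  refine Prod.ext (funext fun i => ?_) rfl
  refine Fin.cases ?_ (fun j => ?_) i <;> simp [history, prepend, History.prepend]

namespace Problem

variable {n m l : ℕ} {P : Problem n m l}

instance (t : ℕ) : IsProbabilityMeasure (P.ν t) := P.isProbabilityMeasure_ν t

instance (π : P.Strategy) (k : ℕ) : IsMarkovKernel (π.kernel k) := π.isMarkovKernel k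

variable (P) in
/-- The path prolonged by the control `u` and the disturbance `w`. -/
def extend {k : ℕ} (ω : Path n m l k) (u : E m) (w : E l) : Path n m l (k + 1) :=
  (Fin.snoc ω.1 (ω.2, u, w), P.f ω.2 u w)

theorem measurable_extend {k : ℕ} :
    Measurable fun p : Path n m l k × E m × E l => P.extend p.1 p.2.1 p.2.2 := by
  refine Measurable.prodMk (measurable_pi_lambda _ fun i => ?_)
    (P.measurable_f.comp (by fun_prop : Measurable fun p : Path n m l k × E m × E l =>
      (p.1.2, p.2.1, p.2.2)))
  refine Fin.lastCases ?_ (fun j => ?_) i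
  · simp only [Fin.snoc_last]; fun_prop
  · simp only [Fin.snoc_castSucc]; fun_prop

theorem extend_prepend {k : ℕ} (x : E n) (u u' : E m) (w w' : E l) (ω : Path n m l k) :
    P.extend (ω.prepend x u w) u' w' = (P.extend ω u' w').prepend x u w := by
  refine Prod.ext ?_ rfl
  exact (Fin.cons_snoc_eq_snoc_cons _ _ _).symm

instance isProbabilityMeasure_pathLaw (π : P.Strategy) (t : ℕ) (x : E n) (k : ℕ) :
    IsProbabilityMeasure (pathLaw π t x k) := by
  induction k with
  | zero => rw [pathLaw]; infer_instance
  | succ k ih =>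
    rw [pathLaw]
    exact Measure.isProbabilityMeasure_map measurable_extend.aemeasurable

theorem lintegral_pathLaw_zero (π : P.Strategy) (t : ℕ) (x : E n) {F : Path n m l 0 → ℝ≥0∞}
    (hF : Measurable F) : ∫⁻ ω, F ω ∂pathLaw π t x 0 = F (Fin.elim0, x) := by
  rw [pathLaw, lintegral_dirac' _ hF]

/-- Integration against the law of the path, the last step being taken last. -/
theorem lintegral_pathLaw_succ (π : P.Strategy) (t : ℕ) (x : E n) (k : ℕ)
    {F : Path n m l (k + 1) → ℝ≥0∞} (hF : Measurable F) :
    ∫⁻ ω, F ω ∂pathLaw π t x (k + 1) =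
      ∫⁻ ω, ∫⁻ u, ∫⁻ w, F (P.extend ω u w) ∂P.ν (t + k) ∂π.kernel k ω.history
        ∂pathLaw π t x k := by
  have hFe := hF.comp (measurable_extend (P := P) (k := k))
  rw [pathLaw]
  refine (lintegral_map hF measurable_extend).trans ?_
  refine (Measure.lintegral_compProd hFe).trans ?_
  refine lintegral_congr fun ω => ?_
  rw [Kernel.prod_apply, Kernel.const_apply, Kernel.comap_apply]
  exact lintegral_prod _ (hFe.comp (measurable_prodMk_left (x := ω))).aemeasurable

/-- The continuation of a strategy after the first step, in which the state was `x` and the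
disturbance `w`. -/
noncomputable def Strategy.tail (π : P.Strategy) (x : E n) (w : E l) : P.Strategy where
  kernel k := (π.kernel (k + 1)).comap (History.prepend x w)
    (History.measurable_prepend_right x w)
  isMarkovKernel _ := inferInstance
  mem_U k _ := π.mem_U (k + 1) _

theorem Strategy.kernel_tail_apply (π : P.Strategy) (x : E n) (w : E l) (k : ℕ)
    (h : History n l k) : (π.tail x w).kernel k h = π.kernel (k + 1) (h.prepend x w) := rfl

/-- The history consisting of an initial state only. -/
def initialHistory (x : E n) : History n l 0 := (Fin.elim0, x)

/-- Integration against the law of the path, the first step being singled out. -/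
theorem lintegral_pathLaw_succ' (π : P.Strategy) (t : ℕ) (x : E n) (k : ℕ)
    {F : Path n m l (k + 1) → ℝ≥0∞} (hF : Measurable F) :
    ∫⁻ ω, F ω ∂pathLaw π t x (k + 1) =
      ∫⁻ u, ∫⁻ w, ∫⁻ ω, F (ω.prepend x u w) ∂pathLaw (π.tail x w) (t + 1) (P.f x u w) k
        ∂P.ν t ∂π.kernel 0 (initialHistory x) := by
  induction k with
  | zero =>
    rw [lintegral_pathLaw_succ π t x 0 hF, lintegral_pathLaw_zero]
    · have h0 : Path.history (m := m) ((Fin.elim0, x) : Path n m l 0) = initialHistory x :=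
        Prod.ext (Subsingleton.elim _ _) rfl
      rw [h0]
      refine lintegral_congr fun u => lintegral_congr fun w => ?_
      refine Eq.trans ?_ (lintegral_pathLaw_zero _ _ _
        (hF.comp (Path.measurable_prepend_right x u w))).symm
      refine congrArg F (Prod.ext (funext fun i => ?_) rfl)
      obtain rfl : i = Fin.last 0 := Fin.ext (by omega)
      simp [extend, Path.prepend, Fin.snoc, Fin.last]
    · have h1 := hF.comp (measurable_extend (P := P) (k := 0))
      have h2 : Measurable fun p : Path n m l 0 × E m =>
          ∫⁻ w, F (P.extend p.1 p.2 w) ∂P.ν (t + 0) :=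
        Measurable.lintegral_prod_right' (ν := P.ν (t + 0))
          (f := fun q : (Path n m l 0 × E m) × E l => F (P.extend q.1.1 q.1.2 q.2))
          (h1.comp (by fun_prop : Measurable fun q : (Path n m l 0 × E m) × E l =>
            (q.1.1, q.1.2, q.2)))
      exact Measurable.lintegral_kernel_prod_right'
        (κ := (π.kernel 0).comap Path.history Path.measurable_history) h2
  | succ k ih =>
    have h1 := hF.comp (measurable_extend (P := P) (k := k + 1))
    have h2 : Measurable fun p : Path n m l (k + 1) × E m =>
        ∫⁻ w, F (P.extend p.1 p.2 w) ∂P.ν (t + (k + 1)) :=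
      Measurable.lintegral_prod_right' (ν := P.ν (t + (k + 1)))
        (f := fun q : (Path n m l (k + 1) × E m) × E l => F (P.extend q.1.1 q.1.2 q.2))
        (h1.comp (by fun_prop : Measurable fun q : (Path n m l (k + 1) × E m) × E l =>
          (q.1.1, q.1.2, q.2)))
    have h3 := Measurable.lintegral_kernel_prod_right'
        (κ := (π.kernel (k + 1)).comap Path.history Path.measurable_history) h2
    rw [lintegral_pathLaw_succ π t x (k + 1) hF]
    refine (ih h3).trans (lintegral_congr fun u => lintegral_congr fun w => ?_)
    refine Eq.trans ?_ (lintegral_pathLaw_succ _ _ _ _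
      (hF.comp (Path.measurable_prepend_right x u w))).symm
    refine lintegral_congr fun ω => ?_
    simp only [Kernel.comap_apply, Path.history_prepend, Strategy.kernel_tail_apply,
      extend_prepend, show t + 1 + k = t + (k + 1) by omega, Function.comp_apply]

/-- A family of strategies is measurable if the control laws depend jointly measurably on the
parameter and the history. -/
def MeasurableFamily {S : Type*} [MeasurableSpace S] (σ : S → P.Strategy) : Prop :=
  ∀ k, Measurable fun p : S × History n l k => (σ p.1).kernel k p.2

theorem measurableFamily_tail (π : P.Strategy) :
    MeasurableFamily fun p : E n × E l => π.tail p.1 p.2 := fun k =>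
  (π.kernel (k + 1)).measurable.comp History.measurable_prepend

theorem MeasurableFamily.comp {S S' : Type*} [MeasurableSpace S] [MeasurableSpace S']
    {σ : S → P.Strategy} (hσ : MeasurableFamily σ) {g : S' → S} (hg : Measurable g) :
    MeasurableFamily fun s => σ (g s) := fun k =>
  (hσ k).comp ((hg.comp measurable_fst).prodMk measurable_snd)

/-- The law of the path depends measurably on the strategy and the initial state. -/
theorem MeasurableFamily.measurable_pathLaw {S : Type*} [MeasurableSpace S] {σ : S → P.Strategy}
    (hσ : MeasurableFamily σ) (t k : ℕ) :
    Measurable fun p : S × E n => pathLaw (σ p.1) t p.2 k := by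
  induction k with
  | zero =>
    simp only [pathLaw]
    exact Measure.measurable_dirac.comp (measurable_const.prodMk measurable_snd)
  | succ k ih =>
    refine Measure.measurable_of_measurable_coe _ fun s hs => ?_
    let η : Kernel (S × E n) (Path n m l k) := ⟨_, ih⟩
    have : IsMarkovKernel η := ⟨fun p => isProbabilityMeasure_pathLaw _ _ _ _⟩
    let κ : Kernel (S × History n l k) (E m) := ⟨_, hσ k⟩
    have : IsMarkovKernel κ := ⟨fun p => (σ p.1).isMarkovKernel k |>.isProbabilityMeasure p.2⟩
    let κ' : Kernel ((S × E n) × Path n m l k) (E m) :=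
      κ.comap (fun q => (q.1.1, q.2.history))
        ((measurable_fst.comp measurable_fst).prodMk
          (Path.measurable_history.comp measurable_snd))
    have hF : Measurable (s.indicator (1 : Path n m l (k + 1) → ℝ≥0∞)) :=
      measurable_one.indicator hs
    have h1 := hF.comp (measurable_extend (P := P) (k := k))
    have h2 : Measurable fun p : ((S × E n) × Path n m l k) × E m =>
        ∫⁻ w, s.indicator 1 (P.extend p.1.2 p.2 w) ∂P.ν (t + k) :=
      Measurable.lintegral_prod_right' (ν := P.ν (t + k))
        (f := fun q : (((S × E n) × Path n m l k) × E m) × E l =>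
          s.indicator (1 : Path n m l (k + 1) → ℝ≥0∞) (P.extend q.1.1.2 q.1.2 q.2))
        (h1.comp (by fun_prop : Measurable fun q : (((S × E n) × Path n m l k) × E m) × E l =>
          (q.1.1.2, q.1.2, q.2)))
    have h3 := Measurable.lintegral_kernel_prod_right' (κ := κ') h2
    have h4 := Measurable.lintegral_kernel_prod_right' (κ := η) h3
    convert! h4 using 1
    funext p
    rw [← lintegral_indicator_one hs, lintegral_pathLaw_succ _ _ _ _ hF]
    rfl

theorem MeasurableFamily.measurable_lintegral_pathLaw {S : Type*} [MeasurableSpace S]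
    {σ : S → P.Strategy} (hσ : MeasurableFamily σ) (t k : ℕ)
    {F : (S × E n) × Path n m l k → ℝ≥0∞} (hF : Measurable F) :
    Measurable fun p : S × E n => ∫⁻ ω, F (p, ω) ∂pathLaw (σ p.1) t p.2 k := by
  let η : Kernel (S × E n) (Path n m l k) := ⟨_, hσ.measurable_pathLaw t k⟩
  have : IsMarkovKernel η := ⟨fun p => isProbabilityMeasure_pathLaw _ _ _ _⟩
  exact Measurable.lintegral_kernel_prod_right' (κ := η) hF

/-- The integral over the continuation depends measurably on the first control and the first
disturbance. -/
theorem measurable_lintegral_prepend (π : P.Strategy) (t : ℕ) (x : E n) (k : ℕ)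
    {F : Path n m l (k + 1) → ℝ≥0∞} (hF : Measurable F) :
    Measurable fun p : E m × E l =>
      ∫⁻ ω, F (ω.prepend x p.1 p.2) ∂pathLaw (π.tail x p.2) (t + 1) (P.f x p.1 p.2) k := by
  have hσ : MeasurableFamily fun p : E m × E l => π.tail x p.2 :=
    (measurableFamily_tail π).comp (measurable_const.prodMk measurable_snd)
  have h := hσ.measurable_lintegral_pathLaw (t + 1) k
    (F := fun q => F (q.2.prepend x q.1.1.1 q.1.1.2))
    (hF.comp (Path.measurable_prepend.comp (by fun_prop :
      Measurable fun q : ((E m × E l) × E n) × Path n m l k =>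
        ((x, q.1.1.1, q.1.1.2), q.2))))
  have hf : Measurable fun p : E m × E l => P.f x p.1 p.2 :=
    P.measurable_f.comp (by fun_prop : Measurable fun p : E m × E l => (x, p.1, p.2))
  exact h.comp (measurable_id.prodMk hf)

/-- Almost sure properties of a path, the first step being singled out. -/
theorem ae_pathLaw_succ_iff (π : P.Strategy) (t : ℕ) (x : E n) (k : ℕ)
    {s : Set (Path n m l (k + 1))} (hs : MeasurableSet s) :
    (∀ᵐ ω ∂pathLaw π t x (k + 1), ω ∈ s) ↔
      ∀ᵐ u ∂π.kernel 0 (initialHistory x), ∀ᵐ w ∂P.ν t,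
        ∀ᵐ ω ∂pathLaw (π.tail x w) (t + 1) (P.f x u w) k, ω.prepend x u w ∈ s := by
  have hF : Measurable (sᶜ.indicator (1 : Path n m l (k + 1) → ℝ≥0∞)) :=
    measurable_one.indicator hs.compl
  have hm := measurable_lintegral_prepend π t x k hF
  have key : (∀ᵐ ω ∂pathLaw π t x (k + 1), ω ∈ s) ↔
      ∫⁻ ω, sᶜ.indicator 1 ω ∂pathLaw π t x (k + 1) = 0 := by
    rw [lintegral_indicator_one hs.compl, ae_iff]
    rfl
  rw [key, lintegral_pathLaw_succ' π t x k hF,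
    lintegral_eq_zero_iff (Measurable.lintegral_prod_right' (ν := P.ν t) hm)]
  refine Filter.eventually_congr (Filter.Eventually.of_forall fun u => ?_)
  simp only [Pi.zero_apply]
  refine (lintegral_eq_zero_iff (hm.comp (measurable_prodMk_left (x := u)))).trans ?_
  refine Filter.eventually_congr (Filter.Eventually.of_forall fun w => ?_)
  simp only [Pi.zero_apply]
  refine (lintegral_eq_zero_iff (hF.comp (Path.measurable_prepend_right x u w))).trans ?_
  refine Filter.eventually_congr (Filter.Eventually.of_forall fun ω => ?_)
  simp

/-- Given the information at stage `t + i`, the next state has the law of `f(x, u, w)` where `w` is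
distributed according to `ν (t + i)`. -/
theorem lintegral_info_state_succ (π : P.Strategy) (t : ℕ) (x : E n) (k : ℕ) (i : Fin k)
    {H : ((Fin (i : ℕ) → E n × E m × E l) × E n × E m) × E n → ℝ≥0∞} (hH : Measurable H) :
    ∫⁻ ω, H (Path.info i ω, ω.state i.succ) ∂pathLaw π t x k =
      ∫⁻ ω, ∫⁻ w, H (Path.info i ω, P.f (ω.1 i).1 (ω.1 i).2.1 w) ∂P.ν (t + i)
        ∂pathLaw π t x k := by
  induction k with
  | zero => exact i.elim0
  | succ k ih =>
    have hm1 : Measurable fun ω : Path n m l (k + 1) => H (Path.info i ω, ω.state i.succ) :=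
      hH.comp ((Path.measurable_info i).prodMk (Path.measurable_state _))
    have hm2 : Measurable fun ω : Path n m l (k + 1) =>
        ∫⁻ w, H (Path.info i ω, P.f (ω.1 i).1 (ω.1 i).2.1 w) ∂P.ν (t + i) := by
      refine Measurable.lintegral_prod_right' (ν := P.ν (t + i))
        (f := fun q : Path n m l (k + 1) × E l =>
          H (Path.info i q.1, P.f (q.1.1 i).1 (q.1.1 i).2.1 q.2)) ?_
      exact hH.comp (((Path.measurable_info i).comp measurable_fst).prodMk
        (P.measurable_f.comp (by fun_prop : Measurable fun q : Path n m l (k + 1) × E l =>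
          ((q.1.1 i).1, (q.1.1 i).2.1, q.2))))
    rw [lintegral_pathLaw_succ _ _ _ _ hm1, lintegral_pathLaw_succ _ _ _ _ hm2]
    clear hm1 hm2
    induction i using Fin.lastCases with
    | last =>
      refine lintegral_congr fun ω => lintegral_congr fun u => ?_
      have hinfo : ∀ w, Path.info (Fin.last k) (P.extend ω u w) =
          (fun j => ω.1 j, ω.2, u) := by
        intro w
        refine Prod.ext (funext fun j => ?_) ?_
        · change (Fin.snoc ω.1 (ω.2, u, w) : Fin (k + 1) → _) (Fin.castSucc j) = _
          simp
        · simp [Path.info, extend]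
      have hst : ∀ w, (P.extend ω u w).state (Fin.last k).succ = P.f ω.2 u w := by
        intro w
        rw [Fin.succ_last]
        simp [extend]
      have h1 : ∀ w, ((P.extend ω u w).1 (Fin.last k)).1 = ω.2 := by simp [extend]
      have h2 : ∀ w, ((P.extend ω u w).1 (Fin.last k)).2.1 = u := by simp [extend]
      simp only [hinfo, hst, h1, h2, lintegral_const, measure_univ, mul_one]
      rfl
    | cast j =>
      have hinfo : ∀ ω u w, Path.info j.castSucc (P.extend ω u w) = Path.info j ω := by
        intro ω u w
        refine Prod.ext (funext fun a => ?_) ?_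
        · change (Fin.snoc ω.1 (ω.2, u, w) : Fin (k + 1) → _)
            (Fin.castSucc (Fin.castLE j.isLt.le a)) = _
          rw [Fin.snoc_castSucc]
          rfl
        · simp [Path.info, extend]
      have hst : ∀ (ω : Path n m l k) u w,
          (P.extend ω u w).state j.castSucc.succ = ω.state j.succ := by
        intro ω u w
        rw [← Fin.castSucc_succ, Path.state_castSucc]
        rcases Fin.eq_castSucc_or_eq_last j.succ with ⟨a, ha⟩ | ha
        · rw [ha]; simp [extend]
        · rw [ha]; simp [extend]
      have h1 : ∀ (ω : Path n m l k) u w, (P.extend ω u w).1 j.castSucc = ω.1 j := by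
        simp [extend]
      simp only [hinfo, hst, h1, lintegral_const, measure_univ, mul_one]
      exact ih j hH

@[simp]
theorem cost_prepend {k : ℕ} (x : E n) (u : E m) (w : E l) (ω : Path n m l k) :
    P.cost (ω.prepend x u w) = P.r x u + P.cost ω := by
  simp [cost, Fin.sum_univ_succ, Path.control, Path.prepend, add_assoc]

theorem measurable_cost {k : ℕ} : Measurable (P.cost : Path n m l k → ℝ) := by
  unfold cost Path.control
  simp only [Path.state_castSucc, Path.state_last]
  refine (Finset.measurable_sum _ fun i _ => ?_).add (P.measurable_q.comp measurable_snd)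
  exact P.measurable_r.comp (by fun_prop : Measurable fun ω : Path n m l k =>
    ((ω.1 i).1, (ω.1 i).2.1))

end Problem

/-! ### Extended expectations -/

theorem ereal_coe_sub_coe (a b : NNReal) :
    ((a : ℝ≥0∞) : EReal) - ((b : ℝ≥0∞) : EReal) = (((a : ℝ) - b : ℝ) : EReal) := by
  push_cast
  rfl

theorem ereal_coe_sub_top (a : NNReal) : ((a : ℝ≥0∞) : EReal) - ((⊤ : ℝ≥0∞) : EReal) = ⊥ := by
  rw [EReal.coe_ennreal_top]
  rfl

theorem ereal_coe_sub_le_coe_sub {p b a c : ℝ≥0∞} (h : p + b ≤ a + c) (hp : p ≠ ⊤) (ha : a ≠ ⊤) :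
    (p : EReal) - c ≤ (a : EReal) - b := by
  induction c using ENNReal.recTopCoe with
  | top =>
    lift p to NNReal using hp
    rw [ereal_coe_sub_top]
    exact bot_le
  | coe c =>
    have hb : b ≠ ⊤ := by
      rintro rfl
      have : a + (c : ℝ≥0∞) ≠ ⊤ := by finiteness
      exact this (top_le_iff.1 (by simpa using h))
    lift p to NNReal using hp
    lift a to NNReal using ha
    lift b to NNReal using hb
    have h' : (p : ℝ) + b ≤ a + c := by exact_mod_cast h
    rw [ereal_coe_sub_coe, ereal_coe_sub_coe, EReal.coe_le_coe_iff]
    linarith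

theorem toENNReal_add_le {x : EReal} {a b : ℝ≥0∞} (ha : a ≠ ⊤) (h : x ≤ (a : EReal) - b) :
    x.toENNReal + b ≤ a + (-x).toENNReal := by
  induction x with
  | bot => simp
  | top =>
    exfalso
    lift a to NNReal using ha
    induction b using ENNReal.recTopCoe with
    | top =>
      rw [ereal_coe_sub_top] at h
      exact absurd h (by simp)
    | coe b =>
      rw [ereal_coe_sub_coe] at h
      exact absurd h (not_le.2 (EReal.coe_lt_top _))
  | coe x =>
    lift a to NNReal using ha
    induction b using ENNReal.recTopCoe with
    | top =>
      rw [ereal_coe_sub_top] at h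
      exact absurd h (by simp)
    | coe b =>
      rw [ereal_coe_sub_coe, EReal.coe_le_coe_iff] at h
      rw [← EReal.coe_neg, EReal.toENNReal_of_ne_top (by simp), EReal.toENNReal_of_ne_top (by simp),
        EReal.toReal_coe, EReal.toReal_coe, ENNReal.ofReal, ENNReal.ofReal]
      norm_cast
      rw [← NNReal.coe_le_coe]
      push_cast
      rw [Real.coe_toNNReal', Real.coe_toNNReal']
      rcases le_total x 0 with hx | hx
      · rw [max_eq_right hx, max_eq_left (by linarith)]; linarith
      · rw [max_eq_left hx, max_eq_right (by linarith)]; linarith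

theorem add_toENNReal_neg_le {x : EReal} {a b : ℝ≥0∞} (ha : a ≠ ⊤) (h : (a : EReal) - b ≤ x) :
    a + (-x).toENNReal ≤ b + x.toENNReal := by
  induction b using ENNReal.recTopCoe with
  | top => simp
  | coe b =>
    lift a to NNReal using ha
    have h2 : -x ≤ ((b : ℝ≥0∞) : EReal) - ((a : ℝ≥0∞) : EReal) := by
      rw [ereal_coe_sub_coe, ← neg_sub, EReal.coe_neg, EReal.neg_le_neg_iff, ← ereal_coe_sub_coe]
      exact h
    have := toENNReal_add_le ENNReal.coe_ne_top h2
    rwa [neg_neg, add_comm] at this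

section Expectation

variable {Ω : Type*} [MeasurableSpace Ω] {ρ : Measure Ω}

theorem expectation_of_ne_top {φ : Ω → EReal} (h : ∫⁻ ω, (φ ω).toENNReal ∂ρ ≠ ⊤) :
    expectation ρ φ = ((∫⁻ ω, (φ ω).toENNReal ∂ρ : ℝ≥0∞) : EReal) -
      ((∫⁻ ω, (-φ ω).toENNReal ∂ρ : ℝ≥0∞) : EReal) := by
  rw [expectation, if_neg h]

theorem expectation_of_eq_top {φ : Ω → EReal} (h : ∫⁻ ω, (φ ω).toENNReal ∂ρ = ⊤) :
    expectation ρ φ = ⊤ := by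
  rw [expectation, if_pos h]

theorem ae_ne_top_of_lintegral_ne_top {φ : Ω → EReal} (hφ : AEMeasurable φ ρ)
    (h : ∫⁻ ω, (φ ω).toENNReal ∂ρ ≠ ⊤) : ∀ᵐ ω ∂ρ, φ ω ≠ ⊤ := by
  filter_upwards [ae_lt_top' hφ.ereal_toENNReal h] with ω hω hφω
  simp [hφω] at hω

theorem lintegral_toENNReal_ne_top_of_ae_le {φ : Ω → EReal} {a b : Ω → ℝ≥0∞}
    (ha : ∫⁻ ω, a ω ∂ρ ≠ ⊤) (h : ∀ᵐ ω ∂ρ, φ ω ≤ (a ω : EReal) - b ω) :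
    ∫⁻ ω, (φ ω).toENNReal ∂ρ ≠ ⊤ := by
  refine ne_top_of_le_ne_top ha (lintegral_mono_ae ?_)
  filter_upwards [h] with ω hω
  rw [← EReal.toENNReal_coe (x := a ω)]
  refine EReal.toENNReal_le_toENNReal (hω.trans ?_)
  exact EReal.sub_le_of_le_add' (le_add_of_nonneg_left (EReal.coe_ennreal_nonneg _))

/-- The expectation of a function that is dominated by a difference of nonnegative functions, the
first of which is integrable. -/
theorem expectation_le_of_ae_le {φ : Ω → EReal} (hφ : AEMeasurable φ ρ) {a b : Ω → ℝ≥0∞}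
    (ham : AEMeasurable a ρ) (ha : ∫⁻ ω, a ω ∂ρ ≠ ⊤) (h : ∀ᵐ ω ∂ρ, φ ω ≤ (a ω : EReal) - b ω) :
    expectation ρ φ ≤ ((∫⁻ ω, a ω ∂ρ : ℝ≥0∞) : EReal) - ((∫⁻ ω, b ω ∂ρ : ℝ≥0∞) : EReal) := by
  have hp := lintegral_toENNReal_ne_top_of_ae_le ha h
  rw [expectation_of_ne_top hp]
  refine ereal_coe_sub_le_coe_sub ?_ hp ha
  rw [← lintegral_add_left' hφ.ereal_toENNReal, ← lintegral_add_left' ham]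
  refine lintegral_mono_ae ?_
  filter_upwards [h, ae_lt_top' ham ha] with ω hω haω
  exact toENNReal_add_le haω.ne hω

/-- The expectation of a function that dominates a difference of nonnegative functions, the first
of which is integrable. -/
theorem le_expectation_of_ae_le {φ : Ω → EReal} {a b : Ω → ℝ≥0∞}
    (ham : AEMeasurable a ρ) (hbm : AEMeasurable b ρ) (ha : ∫⁻ ω, a ω ∂ρ ≠ ⊤)
    (h : ∀ᵐ ω ∂ρ, (a ω : EReal) - b ω ≤ φ ω) :
    ((∫⁻ ω, a ω ∂ρ : ℝ≥0∞) : EReal) - ((∫⁻ ω, b ω ∂ρ : ℝ≥0∞) : EReal) ≤ expectation ρ φ := by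
  by_cases hp : ∫⁻ ω, (φ ω).toENNReal ∂ρ = ⊤
  · rw [expectation_of_eq_top hp]; exact le_top
  rw [expectation_of_ne_top hp]
  refine ereal_coe_sub_le_coe_sub ?_ ha hp
  rw [add_comm (lintegral ρ fun ω => (φ ω).toENNReal), ← lintegral_add_left' ham]
  rw [add_comm, add_comm (lintegral ρ _) (lintegral ρ b), ← lintegral_add_left' hbm]
  refine lintegral_mono_ae ?_
  filter_upwards [h, ae_lt_top' ham ha] with ω hω haω
  exact add_toENNReal_neg_le haω.ne hω

theorem ereal_coe_add_sub (r : ℝ) {p c : ℝ≥0∞} (hp : p ≠ ⊤) :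
    (r : EReal) + ((p : EReal) - c) =
      ((p + ENNReal.ofReal r : ℝ≥0∞) : EReal) - ((c + ENNReal.ofReal (-r) : ℝ≥0∞) : EReal) := by
  lift p to NNReal using hp
  induction c using ENNReal.recTopCoe with
  | top =>
    rw [top_add, ENNReal.ofReal, ← ENNReal.coe_add, ereal_coe_sub_top, ereal_coe_sub_top,
      EReal.add_bot]
  | coe c =>
    rw [ENNReal.ofReal, ENNReal.ofReal, ← ENNReal.coe_add, ← ENNReal.coe_add]
    rw [ereal_coe_sub_coe, ereal_coe_sub_coe, ← EReal.coe_add, EReal.coe_eq_coe_iff]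
    push_cast
    rw [Real.coe_toNNReal', Real.coe_toNNReal']
    rcases le_total r 0 with hr | hr
    · rw [max_eq_right hr, max_eq_left (by linarith)]; ring
    · rw [max_eq_left hr, max_eq_right (by linarith)]; ring

theorem ereal_eq_toENNReal_sub (x : EReal) :
    x = (x.toENNReal : EReal) - ((-x).toENNReal : EReal) := by
  rcases le_total 0 x with h | h
  · rw [EReal.coe_toENNReal h, EReal.toENNReal_of_nonpos (by simpa using h)]
    simp
  · rw [EReal.toENNReal_of_nonpos h, EReal.coe_toENNReal (by simpa using h)]
    simp

theorem expectation_const_add_le [IsProbabilityMeasure ρ] {φ : Ω → EReal} (hφ : AEMeasurable φ ρ)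
    (r : ℝ) : expectation ρ (fun ω => (r : EReal) + φ ω) ≤ (r : EReal) + expectation ρ φ := by
  by_cases hp : ∫⁻ ω, (φ ω).toENNReal ∂ρ = ⊤
  · rw [expectation_of_eq_top hp]; simp
  rw [expectation_of_ne_top hp, ereal_coe_add_sub r hp]
  have h1 : ∫⁻ ω, ((φ ω).toENNReal + ENNReal.ofReal r) ∂ρ =
      ∫⁻ ω, (φ ω).toENNReal ∂ρ + ENNReal.ofReal r := by
    rw [lintegral_add_right _ measurable_const]; simp
  have h2 : ∫⁻ ω, ((-φ ω).toENNReal + ENNReal.ofReal (-r)) ∂ρ =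
      ∫⁻ ω, (-φ ω).toENNReal ∂ρ + ENNReal.ofReal (-r) := by
    rw [lintegral_add_right _ measurable_const]; simp
  rw [← h1, ← h2]
  refine expectation_le_of_ae_le (hφ.const_add _) (hφ.ereal_toENNReal.add_const _) ?_ ?_
  · rw [h1]; exact ENNReal.add_ne_top.2 ⟨hp, ENNReal.ofReal_ne_top⟩
  · filter_upwards [ae_lt_top' hφ.ereal_toENNReal hp] with ω hω
    rw [← ereal_coe_add_sub r hω.ne, ← ereal_eq_toENNReal_sub]

theorem expectation_const_add [IsProbabilityMeasure ρ] {φ : Ω → EReal} (hφ : AEMeasurable φ ρ)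
    (r : ℝ) : expectation ρ (fun ω => (r : EReal) + φ ω) = (r : EReal) + expectation ρ φ := by
  refine le_antisymm (expectation_const_add_le hφ r) ?_
  have hneg : ∀ x : EReal, ((-r : ℝ) : EReal) + ((r : EReal) + x) = x := fun x => by
    rw [← add_assoc, ← EReal.coe_add]; simp
  have hpos : ∀ x : EReal, (r : EReal) + (((-r : ℝ) : EReal) + x) = x := fun x => by
    rw [← add_assoc, ← EReal.coe_add]; simp
  have h := expectation_const_add_le (hφ.const_add (r : EReal)) (-r)
  simp only [hneg] at h
  calc (r : EReal) + expectation ρ φ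
      ≤ (r : EReal) + (((-r : ℝ) : EReal) + expectation ρ (fun ω => (r : EReal) + φ ω)) := by
        gcongr
    _ = _ := hpos _

theorem expectation_of_nonneg {φ : Ω → ℝ≥0∞} :
    expectation ρ (fun ω => (φ ω : EReal)) = ((∫⁻ ω, φ ω ∂ρ : ℝ≥0∞) : EReal) := by
  have hn : ∀ ω, (-(φ ω : EReal)).toENNReal = 0 := fun ω =>
    EReal.toENNReal_of_nonpos (by simpa using EReal.coe_ennreal_nonneg (φ ω))
  by_cases hp : ∫⁻ ω, φ ω ∂ρ = ⊤
  · rw [expectation_of_eq_top (by simpa using hp), hp]; rfl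
  · rw [expectation_of_ne_top (by simpa using hp)]
    simp only [hn, EReal.toENNReal_coe, lintegral_zero, EReal.coe_ennreal_zero, sub_zero]

theorem toENNReal_coe_real (x : ℝ) : (x : EReal).toENNReal = ENNReal.ofReal x := by
  rw [EReal.toENNReal_of_ne_top (by simp), EReal.toReal_coe]

theorem expectation_const (ρ : Measure Ω) [IsProbabilityMeasure ρ]
    (a : EReal) : expectation ρ (fun _ => a) = a := by
  by_cases ha : a = ⊤
  · subst ha
    exact expectation_of_eq_top (by simp)
  · rw [expectation_of_ne_top]
    · simp only [lintegral_const, measure_univ, mul_one]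
      exact (ereal_eq_toENNReal_sub a).symm
    · simpa using ha

theorem expectation_dirac (y : Ω) {φ : Ω → EReal}
    (hφ : Measurable φ) : expectation (Measure.dirac y) φ = φ y := by
  have h := expectation_const (Measure.dirac y) (φ y)
  have hn : Measurable fun ω => (-φ ω).toENNReal :=
    (continuous_neg.measurable.comp hφ).ereal_toENNReal
  unfold expectation at h ⊢
  simpa [lintegral_dirac' _ hφ.ereal_toENNReal, lintegral_dirac' _ hn] using h

theorem expectation_map {Ω' : Type*} [MeasurableSpace Ω'] (μ : Measure Ω)
    {h : Ω → Ω'} (hh : Measurable h) {φ : Ω' → EReal} (hφ : Measurable φ) :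
    expectation (μ.map h) φ = expectation μ fun ω => φ (h ω) := by
  have hn : Measurable fun ω => (-φ ω).toENNReal :=
    (continuous_neg.measurable.comp hφ).ereal_toENNReal
  simp only [expectation]
  rw [lintegral_map hφ.ereal_toENNReal hh, lintegral_map hn hh]

/-- Tower property, upper bound: if the law `M` is a mixture of laws `κ ω`, and `g` has a
well-defined expectation under `M` and conditional expectations at most `θ`, then its expectation
is at most that of `θ`. -/
theorem expectation_le_expectation_of_mixture {Ω' : Type*} [MeasurableSpace Ω']
    {M : Measure Ω'} {κ : Ω → Measure Ω'} {g : Ω' → ℝ}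
    (hM : ∀ F : Ω' → ℝ≥0∞, Measurable F → ∫⁻ y, F y ∂M = ∫⁻ ω, ∫⁻ y, F y ∂κ ω ∂ρ)
    (hκ : ∀ F : Ω' → ℝ≥0∞, Measurable F → AEMeasurable (fun ω => ∫⁻ y, F y ∂κ ω) ρ)
    (hg : Measurable g)
    (hwd : ∫⁻ y, ENNReal.ofReal (g y) ∂M ≠ ⊤ ∨ ∫⁻ y, ENNReal.ofReal (-g y) ∂M ≠ ⊤)
    {θ : Ω → EReal} (hθm : AEMeasurable θ ρ) (hθ : ∫⁻ ω, (θ ω).toENNReal ∂ρ ≠ ⊤)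
    (h : ∀ᵐ ω ∂ρ, expectation (κ ω) (fun y => (g y : EReal)) ≤ θ ω) :
    expectation M (fun y => (g y : EReal)) ≤ expectation ρ θ := by
  have hgp : Measurable fun y => ENNReal.ofReal (g y) := hg.ennreal_ofReal
  have hgn : Measurable fun y => ENNReal.ofReal (-g y) := hg.neg.ennreal_ofReal
  have hE : ∀ N : Measure Ω', ∫⁻ y, ENNReal.ofReal (g y) ∂N ≠ ⊤ →
      expectation N (fun y => (g y : EReal)) =
        ((∫⁻ y, ENNReal.ofReal (g y) ∂N : ℝ≥0∞) : EReal) -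
          ((∫⁻ y, ENNReal.ofReal (-g y) ∂N : ℝ≥0∞) : EReal) := by
    intro N hN
    rw [expectation_of_ne_top (by simpa only [toENNReal_coe_real] using hN)]
    simp only [← EReal.coe_neg, toENNReal_coe_real]
  have hfin : ∀ᵐ ω ∂ρ, ∫⁻ y, ENNReal.ofReal (g y) ∂κ ω ≠ ⊤ := by
    filter_upwards [h, ae_ne_top_of_lintegral_ne_top hθm hθ] with ω hω hθω htop
    rw [expectation_of_eq_top (by simpa only [toENNReal_coe_real] using htop)] at hω
    exact hθω (top_le_iff.1 hω)
  have hle : ∀ᵐ ω ∂ρ, ((∫⁻ y, ENNReal.ofReal (g y) ∂κ ω : ℝ≥0∞) : EReal) -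
      ((∫⁻ y, ENNReal.ofReal (-g y) ∂κ ω : ℝ≥0∞) : EReal) ≤ θ ω := by
    filter_upwards [h, hfin] with ω hω hfω
    rwa [hE _ hfω] at hω
  -- if only the negative part is known to be integrable, then so is the positive part
  have hpos : ∫⁻ y, ENNReal.ofReal (g y) ∂M ≠ ⊤ := by
    rcases hwd with hwd | hwd
    · exact hwd
    rw [hM _ hgn] at hwd
    rw [hM _ hgp]
    refine ne_top_of_le_ne_top (ENNReal.add_ne_top.2 ⟨hwd, hθ⟩) ?_
    rw [← lintegral_add_left' (hκ _ hgn)]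
    refine lintegral_mono_ae ?_
    filter_upwards [hle, hfin] with ω hω hfω
    exact le_self_add.trans (add_toENNReal_neg_le hfω hω)
  rw [hE M hpos, hM _ hgp, hM _ hgn]
  exact le_expectation_of_ae_le (hκ _ hgp) (hκ _ hgn) (by rwa [← hM _ hgp]) hle

end Expectation

/-! ### The risk of a state-control pair -/

theorem ereal_coe_add_coe (z : ℝ) (e : NNReal) :
    (z : EReal) + ((e : ℝ≥0∞) : EReal) = ((z + e : ℝ) : EReal) := by
  push_cast
  rfl

section Excess

variable {W : Type*} [MeasurableSpace W]

/-- The expected excess `E[(X - z)⁺ / (1 - α)]` over the level `z`. -/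
noncomputable def excess (ν : Measure W) (α : ℝ) (X : W → ℝ) (z : ℝ) : ℝ≥0∞ :=
  ∫⁻ w, ENNReal.ofReal (max (X w - z) 0 / (1 - α)) ∂ν

/-- The conditional value-at-risk as the infimum of `z + E[(X - z)⁺ / (1 - α)]` over the rational
levels `z`. -/
noncomputable def cvar (ν : Measure W) (α : ℝ) (X : W → ℝ) : EReal :=
  ⨅ z : ℚ, (((z : ℝ) : EReal) + (excess ν α X z : EReal))

variable {ν : Measure W} {α : ℝ} {X : W → ℝ}

theorem antitone_excess (hα : α < 1) : Antitone (excess ν α X) := by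
  intro y z hyz
  refine lintegral_mono fun w => ENNReal.ofReal_le_ofReal ?_
  have : 0 ≤ 1 - α := by linarith
  gcongr

/-- The excess is antitone in the level, so that rational levels suffice. -/
theorem cvar_le (hα : α < 1) (z : ℝ) : cvar ν α X ≤ (z : EReal) + (excess ν α X z : EReal) := by
  refine le_of_forall_gt fun c hc => ?_
  have hex : excess ν α X z ≠ ⊤ := by
    intro h
    rw [h] at hc
    simp at hc
  lift excess ν α X z to NNReal using hex with e he
  induction c with
  | bot => simp at hc
  | top =>
    refine lt_of_le_of_lt (iInf_le _ (⌈z⌉₊ : ℚ)) ?_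
    have h1 : excess ν α X ((⌈z⌉₊ : ℚ) : ℝ) ≤ e := he ▸ antitone_excess hα (by
      push_cast; exact Nat.le_ceil z)
    have h2 : excess ν α X ((⌈z⌉₊ : ℚ) : ℝ) ≠ ⊤ := ne_top_of_le_ne_top ENNReal.coe_ne_top h1
    lift excess ν α X ((⌈z⌉₊ : ℚ) : ℝ) to NNReal using h2 with e'
    exact EReal.coe_lt_top (((⌈z⌉₊ : ℚ) : ℝ) + (e' : ℝ))
  | coe c =>
    have hc' : z + e < c := by rwa [ereal_coe_add_coe, EReal.coe_lt_coe_iff] at hc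
    obtain ⟨q, hzq, hqc⟩ := exists_rat_btwn (show z < c - e by linarith)
    have h1 : excess ν α X q ≤ e := he ▸ antitone_excess hα hzq.le
    calc cvar ν α X ≤ ((q : ℝ) : EReal) + (excess ν α X q : EReal) := iInf_le _ q
      _ ≤ ((q : ℝ) : EReal) + ((e : ℝ≥0∞) : EReal) :=
        add_le_add_right (EReal.coe_ennreal_le_coe_ennreal_iff.2 h1) _
      _ < (c : EReal) := by
        rw [ereal_coe_add_coe, EReal.coe_lt_coe_iff]
        linarith

theorem ereal_coe_add_le_coe_iff {z δ : ℝ} {e : ℝ≥0∞} :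
    (z : EReal) + (e : EReal) ≤ (δ : EReal) ↔ z ≤ δ ∧ e ≤ ENNReal.ofReal (δ - z) := by
  induction e using ENNReal.recTopCoe with
  | top => simp
  | coe e =>
    rw [ereal_coe_add_coe, EReal.coe_le_coe_iff]
    constructor
    · intro h
      have he := e.coe_nonneg
      refine ⟨by linarith, ?_⟩
      rw [ENNReal.le_ofReal_iff_toReal_le ENNReal.coe_ne_top (by linarith)]
      simp only [ENNReal.coe_toReal]
      linarith
    · rintro ⟨hz, he⟩
      rw [ENNReal.le_ofReal_iff_toReal_le ENNReal.coe_ne_top (by linarith)] at he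
      simp only [ENNReal.coe_toReal] at he
      linarith

/-- For a nonnegative random variable the infimum defining the conditional value-at-risk is
attained: near-optimal levels are bounded, and the excess is lower semicontinuous by Fatou's
lemma. -/
theorem cvar_le_coe_iff [IsProbabilityMeasure ν] (hα0 : 0 < α) (hα : α < 1) (hX : Measurable X)
    (hX0 : ∀ w, 0 ≤ X w) (δ : ℝ) :
    cvar ν α X ≤ (δ : EReal) ↔ ∃ z : ℝ, (z : EReal) + (excess ν α X z : EReal) ≤ (δ : EReal) := by
  constructor
  swap
  · rintro ⟨z, hz⟩
    exact (cvar_le hα z).trans hz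
  intro h
  have hα' : 0 < 1 - α := by linarith
  have hseq : ∀ j : ℕ, ∃ q : ℚ, ((q : ℝ) : EReal) + (excess ν α X q : EReal) ≤
      ((δ + 1 / (j + 1) : ℝ) : EReal) := by
    intro j
    have hj : (0 : ℝ) < 1 / (j + 1) := by positivity
    have : cvar ν α X < ((δ + 1 / (j + 1) : ℝ) : EReal) :=
      lt_of_le_of_lt h (by rw [EReal.coe_lt_coe_iff]; linarith)
    obtain ⟨q, hq⟩ := iInf_lt_iff.1 this
    exact ⟨q, hq.le⟩
  choose q hq using hseq
  simp only [ereal_coe_add_le_coe_iff] at hq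
  have hj1 : ∀ j : ℕ, (1 : ℝ) / (j + 1) ≤ 1 := fun j => by
    rw [div_le_one (by positivity)]; linarith [(Nat.cast_nonneg j : (0 : ℝ) ≤ j)]
  -- the levels are bounded below because `E[(X - z)⁺ / (1 - α)] ≥ -z / (1 - α)`
  have hlow : ∀ j, -((|δ| + 1) * (1 - α) / α) ≤ (q j : ℝ) := by
    intro j
    have hδ := le_abs_self δ
    have h1 : ENNReal.ofReal (-(q j : ℝ) / (1 - α)) ≤ excess ν α X (q j) := by
      calc ENNReal.ofReal (-(q j : ℝ) / (1 - α))
          = ∫⁻ _, ENNReal.ofReal (-(q j : ℝ) / (1 - α)) ∂ν := by simp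
        _ ≤ _ := lintegral_mono fun w => ENNReal.ofReal_le_ofReal (by
            gcongr
            exact le_max_of_le_left (by linarith [hX0 w]))
    have h2 := h1.trans (hq j).2
    rw [ENNReal.ofReal_le_ofReal_iff (by linarith [(hq j).1]), div_le_iff₀ hα'] at h2
    rw [neg_le, le_div_iff₀ hα0]
    nlinarith [hj1 j]
  have hmem : ∀ j, (q j : ℝ) ∈ Set.Icc (-((|δ| + 1) * (1 - α) / α)) (δ + 1) := fun j =>
    ⟨hlow j, (hq j).1.trans (by linarith [hj1 j])⟩
  obtain ⟨z, -, φ, hφ, hlim⟩ := isCompact_Icc.tendsto_subseq hmem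
  have hz0 : Filter.Tendsto (fun j => δ + 1 / ((φ j : ℝ) + 1) - (q (φ j) : ℝ)) Filter.atTop
      (nhds (δ - z)) := by
    have h0 := (tendsto_one_div_add_atTop_nhds_zero_nat (𝕜 := ℝ)).comp hφ.tendsto_atTop
    simpa using (h0.const_add δ).sub hlim
  refine ⟨z, ereal_coe_add_le_coe_iff.2 ⟨?_, ?_⟩⟩
  · have := ge_of_tendsto' hz0 fun j => sub_nonneg.2 (hq (φ j)).1
    linarith
  · have hpt : ∀ w, Filter.Tendsto
        (fun j => ENNReal.ofReal (max (X w - (q (φ j) : ℝ)) 0 / (1 - α))) Filter.atTop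
        (nhds (ENNReal.ofReal (max (X w - z) 0 / (1 - α)))) := by
      intro w
      have hc : Continuous fun y : ℝ => ENNReal.ofReal (max (X w - y) 0 / (1 - α)) :=
        ENNReal.continuous_ofReal.comp (by fun_prop)
      exact (hc.tendsto z).comp hlim
    calc excess ν α X z
        = ∫⁻ w, Filter.liminf
            (fun j => ENNReal.ofReal (max (X w - (q (φ j) : ℝ)) 0 / (1 - α))) Filter.atTop ∂ν :=
          lintegral_congr fun w => (hpt w).liminf_eq.symm
      _ ≤ Filter.liminf (fun j => excess ν α X (q (φ j))) Filter.atTop :=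
          lintegral_liminf_le fun j => by fun_prop
      _ ≤ Filter.liminf (fun j => ENNReal.ofReal (δ + 1 / ((φ j : ℝ) + 1) - (q (φ j) : ℝ)))
            Filter.atTop :=
          Filter.liminf_le_liminf (Filter.Eventually.of_forall fun j => (hq (φ j)).2)
      _ = ENNReal.ofReal (δ - z) :=
          ((ENNReal.continuous_ofReal.tendsto _).comp hz0).liminf_eq

theorem expectation_add_excess [IsProbabilityMeasure ν] (hα : α < 1) (hX : Measurable X) (z : ℝ) :
    expectation ν (fun w => ((z + max (X w - z) 0 / (1 - α) : ℝ) : EReal)) =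
      (z : EReal) + (excess ν α X z : EReal) := by
  have hα' : 0 ≤ 1 - α := by linarith
  have h : ∀ w, ((z + max (X w - z) 0 / (1 - α) : ℝ) : EReal) =
      (z : EReal) + (ENNReal.ofReal (max (X w - z) 0 / (1 - α)) : EReal) := by
    intro w
    rw [EReal.coe_add, EReal.coe_ennreal_ofReal, max_eq_left (div_nonneg (le_max_right _ _) hα')]
  have hm : Measurable fun w => ENNReal.ofReal (max (X w - z) 0 / (1 - α)) := by fun_prop
  simp only [h]
  rw [expectation_const_add (hm.coe_ereal_ennreal.aemeasurable), expectation_of_nonneg]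
  rfl

end Excess

namespace Problem

variable {n m l : ℕ} {P : Problem n m l}

variable (P) in
/-- The risk incurred at stage `t` by the control `u` in the state `x`. -/
noncomputable def stageRisk (t : ℕ) (x : E n) (u : E m) : EReal :=
  cvar (P.ν t) P.α fun w => Metric.infDist (P.f x u w) P.A

theorem measurable_infDist_f :
    Measurable fun p : (E n × E m) × E l => Metric.infDist (P.f p.1.1 p.1.2 p.2) P.A :=
  (Metric.continuous_infDist_pt P.A).measurable.comp
    (P.measurable_f.comp (by fun_prop : Measurable fun p : (E n × E m) × E l =>
      (p.1.1, p.1.2, p.2)))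

theorem measurable_infDist_f_right (x : E n) (u : E m) :
    Measurable fun w : E l => Metric.infDist (P.f x u w) P.A :=
  ((measurable_infDist_f (P := P)).comp (measurable_prodMk_left (x := (x, u))) :)

theorem measurable_excess (t : ℕ) :
    Measurable fun p : (E n × E m) × ℝ =>
      excess (P.ν t) P.α (fun w => Metric.infDist (P.f p.1.1 p.1.2 w) P.A) p.2 := by
  refine Measurable.lintegral_prod_right' (ν := P.ν t) (f := fun q : ((E n × E m) × ℝ) × E l =>
    ENNReal.ofReal (max (Metric.infDist (P.f q.1.1.1 q.1.1.2 q.2) P.A - q.1.2) 0 / (1 - P.α))) ?_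
  have h : Measurable fun q : ((E n × E m) × ℝ) × E l =>
      Metric.infDist (P.f q.1.1.1 q.1.1.2 q.2) P.A :=
    ((measurable_infDist_f (P := P)).comp (by fun_prop :
      Measurable fun q : ((E n × E m) × ℝ) × E l => ((q.1.1.1, q.1.1.2), q.2)) :)
  fun_prop

theorem measurable_stageRisk (t : ℕ) :
    Measurable fun p : E n × E m => P.stageRisk t p.1 p.2 := by
  refine Measurable.iInf fun z => Measurable.const_add ?_ _
  exact ((measurable_excess t).comp (measurable_id.prodMk measurable_const)).coe_ereal_ennreal

theorem stageRisk_le_iff (t : ℕ) (x : E n) (u : E m) :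
    P.stageRisk t x u ≤ (P.δ : EReal) ↔
      ∃ z : ℝ, expectation (P.ν t) (fun w =>
        ((z + max (Metric.infDist (P.f x u w) P.A - z) 0 / (1 - P.α) : ℝ) : EReal)) ≤
          (P.δ : EReal) := by
  simp only [expectation_add_excess P.α_lt_one (measurable_infDist_f_right x u)]
  exact cvar_le_coe_iff P.zero_lt_α P.α_lt_one (measurable_infDist_f_right x u)
    (fun w => Metric.infDist_nonneg) P.δ

/-- Under the law of the path, the conditional expectation in the definition of the conditional
value-at-risk is an integral over the next disturbance alone. -/
theorem cvarObjective_ae_eq (π : P.Strategy) (t : ℕ) (x : E n) (k : ℕ) (i : Fin k)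
    {Z : Path n m l k → ℝ} (hZ : Measurable[Path.infoSigma i] Z) :
    ∀ᵐ ω ∂pathLaw π t x k,
      cvarObjective (Path.infoSigma i) (pathLaw π t x k) P.α
          (fun ω => Metric.infDist (ω.state i.succ) P.A) Z ω =
        (Z ω : EReal) + (excess (P.ν (t + i)) P.α
          (fun w => Metric.infDist (P.f (ω.1 i).1 (ω.1 i).2.1 w) P.A) (Z ω) : EReal) := by
  obtain ⟨ζ, hζ, rfl⟩ := hZ.exists_eq_measurable_comp
  have hd : Measurable fun y : E n => Metric.infDist y P.A :=
    (Metric.continuous_infDist_pt P.A).measurable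
  have hG : Measurable fun p : ((Fin (i : ℕ) → E n × E m × E l) × E n × E m) × E n =>
      ENNReal.ofReal (max (Metric.infDist p.2 P.A - ζ p.1) 0 / (1 - P.α)) := by
    have h1 := hd.comp (measurable_snd :
      Measurable fun p : ((Fin (i : ℕ) → E n × E m × E l) × E n × E m) × E n => p.2)
    have h2 := hζ.comp (measurable_fst :
      Measurable fun p : ((Fin (i : ℕ) → E n × E m × E l) × E n × E m) × E n => p.1)
    exact ((((h1.sub h2).max measurable_const).div_const _)).ennreal_ofReal
  have hY : Measurable[Path.infoSigma i] fun ω : Path n m l k =>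
      excess (P.ν (t + i)) P.α
        (fun w => Metric.infDist (P.f (ω.1 i).1 (ω.1 i).2.1 w) P.A) (ζ (Path.info i ω)) :=
    (((measurable_excess (P := P) (t + i)).comp (measurable_snd.prodMk hζ)).comp
      (comap_measurable (Path.info i)) :)
  have key := ae_eq_condLExp (hm := Path.infoSigma_le i) (pathLaw π t x k)
    (fun ω => ENNReal.ofReal
      (max (Metric.infDist (ω.state i.succ) P.A - ζ (Path.info i ω)) 0 / (1 - P.α))) hY ?_
  · filter_upwards [key] with ω hω
    simp only [cvarObjective, Function.comp_apply]
    rw [hω]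
  · rintro _ ⟨S, hS, rfl⟩
    have hpre : MeasurableSet (Path.info i ⁻¹' S : Set (Path n m l k)) := Path.measurable_info i hS
    have hH : Measurable fun p : ((Fin (i : ℕ) → E n × E m × E l) × E n × E m) × E n =>
        S.indicator 1 p.1 *
          ENNReal.ofReal (max (Metric.infDist p.2 P.A - ζ p.1) 0 / (1 - P.α)) :=
      ((measurable_one.indicator hS).comp measurable_fst).mul hG
    rw [← lintegral_indicator hpre, ← lintegral_indicator hpre]
    have hlaw := lintegral_info_state_succ π t x k i hH
    have h1 : ∀ (ω : Path n m l k) (φ : Path n m l k → ℝ≥0∞),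
        (Path.info i ⁻¹' S).indicator φ ω = S.indicator 1 (Path.info i ω) * φ ω := by
      intro ω φ
      by_cases hω : Path.info i ω ∈ S
      · simp [hω]
      · simp [hω]
    simp only [h1]
    rw [hlaw]
    refine lintegral_congr fun ω => ?_
    exact (lintegral_const_mul _ (hG.comp ((measurable_const (a := Path.info i ω)).prodMk
      (P.measurable_f.comp (by fun_prop : Measurable fun w : E l =>
        ((ω.1 i).1, (ω.1 i).2.1, w)))))).symm

/-- The risk constraint says that the state-control pair has risk at most `δ`. Constant rational
levels `Z` are enough to reach the essential infimum. -/
theorem condCVaRLE_iff (π : P.Strategy) (t : ℕ) (x : E n) (k : ℕ) (i : Fin k) :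
    CondCVaRLE (Path.infoSigma i) (pathLaw π t x k) P.α
        (fun ω => Metric.infDist (ω.state i.succ) P.A) P.δ ↔
      ∀ᵐ ω ∂pathLaw π t x k, P.stageRisk (t + i) (ω.1 i).1 (ω.1 i).2.1 ≤ (P.δ : EReal) := by
  have hY : IsCondCVaR (Path.infoSigma i) (pathLaw π t x k) P.α
      (fun ω => Metric.infDist (ω.state i.succ) P.A)
      (fun ω => P.stageRisk (t + i) (ω.1 i).1 (ω.1 i).2.1) := by
    refine ⟨?_, fun Z hZ _ => ?_, fun Y' _ hY' => ?_⟩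
    · exact (((measurable_stageRisk (P := P) (t + i)).comp measurable_snd).comp
        (comap_measurable (Path.info i)) :)
    · filter_upwards [cvarObjective_ae_eq π t x k i hZ] with ω hω
      rw [hω]
      exact cvar_le P.α_lt_one _
    · have h : ∀ z : ℚ, ∀ᵐ ω ∂pathLaw π t x k, Y' ω ≤ ((z : ℝ) : EReal) +
          (excess (P.ν (t + i)) P.α
            (fun w => Metric.infDist (P.f (ω.1 i).1 (ω.1 i).2.1 w) P.A) z : EReal) := by
        intro z
        filter_upwards [hY' (fun _ => (z : ℝ)) measurable_const (memLp_const _),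
          cvarObjective_ae_eq π t x k i (Z := fun _ => (z : ℝ)) measurable_const] with ω h1 h2
        rwa [h2] at h1
      filter_upwards [ae_all_iff.2 h] with ω hω
      exact le_iInf hω
  constructor
  · rintro ⟨Y, hYc, hYδ⟩
    filter_upwards [hYc.greatest _ hY.measurable hY.le_objective, hYδ] with ω h1 h2
    exact h1.trans h2
  · exact fun h => ⟨_, hY, h⟩

/-- The risk constraints of the first `k` stages, in terms of the risks of the state-control
pairs. -/
def IsSafe (π : P.Strategy) (t : ℕ) (x : E n) (k : ℕ) : Prop :=
  ∀ i : Fin k, ∀ᵐ ω ∂pathLaw π t x k, P.stageRisk (t + i) (ω.1 i).1 (ω.1 i).2.1 ≤ (P.δ : EReal)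

theorem feasible_iff (π : P.Strategy) (t : ℕ) (x : E n) :
    Feasible π t x ↔ IsSafe π t x (P.T - t) :=
  forall_congr' fun i => condCVaRLE_iff π t x (P.T - t) i

theorem measurableSet_stageRisk_le {k : ℕ} (t : ℕ) (i : Fin k) :
    MeasurableSet {ω : Path n m l k | P.stageRisk t (ω.1 i).1 (ω.1 i).2.1 ≤ (P.δ : EReal)} :=
  measurableSet_le (((measurable_stageRisk (P := P) t).comp (by fun_prop : Measurable
    fun ω : Path n m l k => ((ω.1 i).1, (ω.1 i).2.1))) :) measurable_const

/-- Safety, the first step being singled out. -/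
theorem isSafe_succ_iff (π : P.Strategy) (t : ℕ) (x : E n) (k : ℕ) :
    IsSafe π t x (k + 1) ↔
      (∀ᵐ u ∂π.kernel 0 (initialHistory x), P.stageRisk t x u ≤ (P.δ : EReal)) ∧
      ∀ᵐ u ∂π.kernel 0 (initialHistory x), ∀ᵐ w ∂P.ν t,
        IsSafe (π.tail x w) (t + 1) (P.f x u w) k := by
  unfold IsSafe
  rw [Fin.forall_fin_succ]
  refine and_congr ?_ ?_
  · refine (ae_pathLaw_succ_iff π t x k
      (measurableSet_stageRisk_le (t + (0 : Fin (k + 1))) 0)).trans ?_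
    refine Filter.eventually_congr (Filter.Eventually.of_forall fun u => ?_)
    simp [Path.prepend]
  · simp only [ae_all_iff]
    refine forall_congr' fun i => ?_
    refine (ae_pathLaw_succ_iff π t x k (measurableSet_stageRisk_le (t + i.succ) i.succ)).trans ?_
    simp [Path.prepend, show t + (i + 1) = t + 1 + i by omega]

end Problem

/-! ### A universal family of strategies -/

/-- The probability measure on `ℝ` whose distribution function extends the given function on `ℚ`
(and a fixed one if there is none). -/
noncomputable def realMeasureOfCode : Kernel (ℚ → ℝ) ℝ where
  toFun c := (stieltjesOfMeasurableRat (fun c : ℚ → ℝ => c) measurable_id c).measure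
  measurable' :=
    (isMeasurableRatCDF_toRatCDF (f := fun c : ℚ → ℝ => c)
      measurable_id).measurable_measure_stieltjesFunction

instance : IsMarkovKernel realMeasureOfCode :=
  ⟨fun c => ⟨(isMeasurableRatCDF_toRatCDF (f := fun c : ℚ → ℝ => c)
    measurable_id).measure_stieltjesFunction_univ c⟩⟩

theorem exists_realMeasureOfCode_eq (μ : Measure ℝ) [IsProbabilityMeasure μ] :
    ∃ c, realMeasureOfCode c = μ := by
  let c : ℚ → ℝ := fun q => cdf μ q
  have hc : IsRatStieltjesPoint (fun c : ℚ → ℝ => c) c := by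
    refine ⟨fun p q hpq => (cdf μ).mono (by exact_mod_cast hpq), ?_, ?_, fun t => ?_⟩
    · exact (tendsto_cdf_atTop μ).comp (tendsto_ratCast_atTop_iff.2 Filter.tendsto_id)
    · exact (tendsto_cdf_atBot μ).comp (tendsto_ratCast_atBot_iff.2 Filter.tendsto_id)
    · have h := (cdf μ).iInf_rat_gt_eq (t : ℝ)
      change ⨅ r : Set.Ioi t, cdf μ ((r : ℚ) : ℝ) = cdf μ t
      rw [← h]
      refine (Equiv.iInf_congr (Equiv.subtypeEquivRight fun q => ?_) fun q => rfl)
      simp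
  have hfun : stieltjesOfMeasurableRat (fun c : ℚ → ℝ => c) measurable_id c = cdf μ := by
    have hq : ∀ q : ℚ, stieltjesOfMeasurableRat (fun c : ℚ → ℝ => c) measurable_id c q =
        cdf μ q := fun q => by
      rw [stieltjesOfMeasurableRat_eq, toRatCDF_of_isRatStieltjesPoint hc]
    ext x
    rw [← StieltjesFunction.iInf_rat_gt_eq, ← StieltjesFunction.iInf_rat_gt_eq (cdf μ)]
    exact iInf_congr fun q => hq q
  refine ⟨c, ?_⟩
  change (stieltjesOfMeasurableRat (fun c : ℚ → ℝ => c) measurable_id c).measure = μ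
  rw [hfun, measure_cdf]

/-- A kernel that takes every probability measure on `X` as a value. -/
noncomputable def measureOfCode (X : Type*) [Nonempty X] [MeasurableSpace X]
    [StandardBorelSpace X] : Kernel (ℚ → ℝ) X :=
  Kernel.borelMarkovFromReal X realMeasureOfCode

instance (X : Type*) [Nonempty X] [MeasurableSpace X] [StandardBorelSpace X] :
    IsMarkovKernel (measureOfCode X) := by
  unfold measureOfCode
  infer_instance

theorem exists_measureOfCode_eq {X : Type*} [Nonempty X] [MeasurableSpace X]
    [StandardBorelSpace X] (μ : Measure X) [IsProbabilityMeasure μ] :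
    ∃ c, measureOfCode X c = μ := by
  have he := measurableEmbedding_embeddingReal X
  have : IsProbabilityMeasure (μ.map (embeddingReal X)) :=
    Measure.isProbabilityMeasure_map he.measurable.aemeasurable
  obtain ⟨c, hc⟩ := exists_realMeasureOfCode_eq (μ.map (embeddingReal X))
  refine ⟨c, ?_⟩
  rw [measureOfCode, Kernel.borelMarkovFromReal_apply, hc, if_pos, he.comap_map]
  rw [he.map_apply, Set.preimage_compl, Set.preimage_range]
  simp

instance (n l k : ℕ) : StandardBorelSpace (History n l k) := by
  have : StandardBorelSpace (Fin k → E n × E l) := StandardBorelSpace.pi_countable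
  exact StandardBorelSpace.prod

namespace Problem

variable {n m l : ℕ} {P : Problem n m l}

/-- Two strategies that agree almost surely along the paths of the second one have the same path
laws. -/
theorem pathLaw_congr {π π' : P.Strategy} {t : ℕ} {x : E n}
    (h : ∀ k, ∀ᵐ ω ∂pathLaw π t x k, π'.kernel k ω.history = π.kernel k ω.history) (k : ℕ) :
    pathLaw π' t x k = pathLaw π t x k := by
  induction k with
  | zero => rfl
  | succ k ih =>
    ext s hs
    have hF : Measurable (s.indicator (1 : Path n m l (k + 1) → ℝ≥0∞)) :=
      measurable_one.indicator hs
    rw [← lintegral_indicator_one hs, ← lintegral_indicator_one hs,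
      lintegral_pathLaw_succ _ _ _ _ hF, lintegral_pathLaw_succ _ _ _ _ hF, ih]
    refine lintegral_congr_ae ?_
    filter_upwards [h k] with ω hω
    rw [hω]

theorem ae_init_history (π : P.Strategy) (t : ℕ) (x : E n) (k : ℕ) :
    ∀ᵐ ω ∂pathLaw π t x k, ω.history.init = x := by
  have hms : MeasurableSet {ω : Path n m l k | ω.history.init = x} :=
    (History.measurable_init.comp Path.measurable_history) (measurableSet_singleton x)
  cases k with
  | zero =>
    rw [pathLaw]
    exact (ae_dirac_iff hms).2 rfl
  | succ k =>
    refine (ae_pathLaw_succ_iff π t x k hms).2 ?_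
    exact Filter.Eventually.of_forall fun u => Filter.Eventually.of_forall fun w =>
      Filter.Eventually.of_forall fun ω => rfl

/-- The strategy that picks a member of a family of strategies according to the initial state. -/
noncomputable def Strategy.select {S : Type*} [MeasurableSpace S] (σ : S → P.Strategy)
    (hσ : MeasurableFamily σ) (s : E n → S) (hs : Measurable s) : P.Strategy where
  kernel k := ⟨fun h => (σ (s h.init)).kernel k h,
    (hσ k).comp ((hs.comp History.measurable_init).prodMk measurable_id)⟩
  isMarkovKernel k := ⟨fun h => (σ (s h.init)).isMarkovKernel k |>.isProbabilityMeasure h⟩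
  mem_U k h := (σ (s h.init)).mem_U k h

theorem pathLaw_select {S : Type*} [MeasurableSpace S] {σ : S → P.Strategy}
    (hσ : MeasurableFamily σ) {s : E n → S} (hs : Measurable s) (t : ℕ) (x : E n) (k : ℕ) :
    pathLaw (Strategy.select σ hσ s hs) t x k = pathLaw (σ (s x)) t x k := by
  refine pathLaw_congr (fun k => ?_) k
  filter_upwards [ae_init_history (σ (s x)) t x k] with ω hω
  change (σ (s ω.history.init)).kernel k ω.history = _
  rw [hω]

/-- The control law at step `k` that is obtained by disintegrating the joint law of history and
control with code `c k`. -/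
noncomputable def codedKernel (n m l k : ℕ) : Kernel ((ℕ → ℚ → ℝ) × History n l k) (E m) :=
  (measureOfCode (History n l k × E m)).condKernel.comap (fun p => (p.1 k, p.2)) (by fun_prop)

instance (n m l k : ℕ) : IsMarkovKernel (codedKernel n m l k) := by
  unfold codedKernel
  infer_instance

variable (P) in
theorem measurableSet_codedKernel_eq_one (k : ℕ) :
    MeasurableSet {p | codedKernel n m l k p P.U = 1} :=
  (codedKernel n m l k).measurable_coe P.measurableSet_U (measurableSet_singleton 1)

open Classical in
variable (P) in
/-- The coded control laws, replaced by a fixed control where they are not carried by the control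
set. -/
noncomputable def admissibleCodedKernel (k : ℕ) : Kernel ((ℕ → ℚ → ℝ) × History n l k) (E m) :=
  Kernel.piecewise (measurableSet_codedKernel_eq_one P k) (codedKernel n m l k)
    (Kernel.const _ (Measure.dirac P.nonempty_U.some))

instance (k : ℕ) : IsMarkovKernel (admissibleCodedKernel P k) := by
  unfold admissibleCodedKernel
  infer_instance

open Classical in
theorem admissibleCodedKernel_apply (k : ℕ) (p : (ℕ → ℚ → ℝ) × History n l k) :
    admissibleCodedKernel P k p = if codedKernel n m l k p P.U = 1 then codedKernel n m l k p
      else Measure.dirac P.nonempty_U.some := by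
  rw [admissibleCodedKernel, Kernel.piecewise_apply]
  rfl

/-- The strategy with code `c`: at step `k` the control is drawn from the disintegration of the
joint law of history and control that has the code `c k`. -/
noncomputable def codedStrategy (c : ℕ → ℚ → ℝ) : P.Strategy where
  kernel k := (admissibleCodedKernel P k).comap (fun h => (c, h)) measurable_prodMk_left
  isMarkovKernel _ := inferInstance
  mem_U k h := by
    rw [Kernel.comap_apply, admissibleCodedKernel_apply]
    split_ifs with hU
    · exact hU
    · simp [Measure.dirac_apply' _ P.measurableSet_U, P.nonempty_U.some_mem]

theorem measurableFamily_codedStrategy :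
    MeasurableFamily (codedStrategy : (ℕ → ℚ → ℝ) → P.Strategy) := fun k =>
  (admissibleCodedKernel P k).measurable

/-- Up to the law of the path, every strategy has a code. -/
theorem exists_codedStrategy (π : P.Strategy) (t : ℕ) (x : E n) :
    ∃ c, ∀ k, pathLaw (codedStrategy (P := P) c) t x k = pathLaw π t x k := by
  have hprob : ∀ k, IsProbabilityMeasure ((pathLaw π t x k).map Path.history) := fun k =>
    Measure.isProbabilityMeasure_map Path.measurable_history.aemeasurable
  choose c hc using fun k =>
    exists_measureOfCode_eq (((pathLaw π t x k).map Path.history) ⊗ₘ π.kernel k)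
  refine ⟨c, pathLaw_congr fun k => ?_⟩
  have h1 := Kernel.condKernel_apply_eq_condKernel (measureOfCode (History n l k × E m)) (c k)
  have hfst : (measureOfCode (History n l k × E m) (c k)).fst =
      (pathLaw π t x k).map Path.history := by rw [hc k, Measure.fst_compProd]
  have h2 := eq_condKernel_of_measure_eq_compProd
    (ρ := measureOfCode (History n l k × E m) (c k)) (π.kernel k) (by rw [hfst, hc k])
  rw [Kernel.fst_apply] at h1
  change _ =ᵐ[Measure.fst _] _ at h1
  rw [hfst] at h1 h2
  filter_upwards [ae_of_ae_map Path.measurable_history.aemeasurable h1,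
    ae_of_ae_map Path.measurable_history.aemeasurable h2] with ω hω hω2
  have hω' : codedKernel n m l k (c, ω.history) = π.kernel k ω.history := hω.trans hω2.symm
  change admissibleCodedKernel P k (c, ω.history) = _
  rw [admissibleCodedKernel_apply, hω', if_pos (π.mem_U k _)]

/-! ### Measurability of the value function and near-optimal strategies -/

theorem expectation_cost_eq {k : ℕ} (μ : Measure (Path n m l k)) [Decidable
    (∫⁻ ω, ENNReal.ofReal (P.cost ω) ∂μ = ⊤)] :
    expectation μ (fun ω => (P.cost ω : EReal)) =
      if ∫⁻ ω, ENNReal.ofReal (P.cost ω) ∂μ = ⊤ then ⊤ else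
        ((∫⁻ ω, ENNReal.ofReal (P.cost ω) ∂μ : ℝ≥0∞) : EReal) -
          ((∫⁻ ω, ENNReal.ofReal (-P.cost ω) ∂μ : ℝ≥0∞) : EReal) := by
  simp only [expectation, ← EReal.coe_neg, toENNReal_coe_real]

theorem MeasurableFamily.measurable_expectation_cost {S : Type*} [MeasurableSpace S]
    {σ : S → P.Strategy} (hσ : MeasurableFamily σ) (t k : ℕ) :
    Measurable fun p : S × E n =>
      expectation (pathLaw (σ p.1) t p.2 k) (fun ω => (P.cost ω : EReal)) := by
  classical
  have hc : Measurable fun q : (S × E n) × Path n m l k => P.cost q.2 :=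
    measurable_cost.comp measurable_snd
  have h1 := hσ.measurable_lintegral_pathLaw t k hc.ennreal_ofReal
  have h2 := hσ.measurable_lintegral_pathLaw t k hc.neg.ennreal_ofReal
  simp only [expectation_cost_eq]
  refine Measurable.ite (h1 (measurableSet_singleton ⊤)) measurable_const ?_
  simp only [sub_eq_add_neg]
  exact h1.coe_ereal_ennreal.add (continuous_neg.measurable.comp h2.coe_ereal_ennreal)

theorem MeasurableFamily.measurableSet_isSafe {S : Type*} [MeasurableSpace S]
    {σ : S → P.Strategy} (hσ : MeasurableFamily σ) (t k : ℕ) :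
    MeasurableSet {p : S × E n | IsSafe (σ p.1) t p.2 k} := by
  simp only [IsSafe, Set.ofPred_forall]
  refine MeasurableSet.iInter fun i => ?_
  have hs : MeasurableSet {ω : Path n m l k |
      P.stageRisk (t + i) (ω.1 i).1 (ω.1 i).2.1 ≤ (P.δ : EReal)}ᶜ :=
    (measurableSet_stageRisk_le (t + i) i).compl
  exact ((Measure.measurable_coe hs).comp (hσ.measurable_pathLaw t k)) (measurableSet_singleton 0)

variable (P) in
/-- The pairs of an initial state and a code whose strategy is safe and has expected cost less than
`θ`. -/
def codesBelow (t : ℕ) (θ : E n → EReal) : Set (E n × (ℕ → ℚ → ℝ)) :=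
  {p | Feasible (codedStrategy (P := P) p.2) t p.1 ∧
    expectedCost (codedStrategy (P := P) p.2) t p.1 < θ p.1}

theorem measurableSet_codesBelow (t : ℕ) {θ : E n → EReal} (hθ : Measurable θ) :
    MeasurableSet (codesBelow P t θ) := by
  have hσ : MeasurableFamily fun c => codedStrategy (P := P) c := measurableFamily_codedStrategy
  simp only [codesBelow, feasible_iff, expectedCost]
  exact (measurable_swap (hσ.measurableSet_isSafe t (P.T - t)) :).inter
    (measurableSet_lt ((hσ.measurable_expectation_cost t (P.T - t)).comp measurable_swap)
      (hθ.comp measurable_fst))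

theorem value_lt_iff (t : ℕ) (θ : E n → EReal) (x : E n) :
    P.value t x < θ x ↔ ∃ c, (x, c) ∈ codesBelow P t θ := by
  constructor
  · intro h
    obtain ⟨π, hπ⟩ := iInf_lt_iff.1 h
    obtain ⟨hf, hc⟩ := iInf_lt_iff.1 hπ
    obtain ⟨c, hcode⟩ := exists_codedStrategy π t x
    refine ⟨c, ?_, ?_⟩
    · rw [Feasible, hcode]; exact hf
    · rw [expectedCost, hcode]; exact hc
  · rintro ⟨c, hf, hc⟩
    exact lt_of_le_of_lt (iInf₂_le (codedStrategy c) hf) hc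

/-- The sublevel sets of the value function are projections of Borel sets. -/
theorem aemeasurable_value (t : ℕ) (μ : Measure (E n)) [IsFiniteMeasure μ] :
    AEMeasurable (P.value t) μ := by
  refine NullMeasurable.aemeasurable ?_
  have h : ∀ a, NullMeasurableSet (P.value t ⁻¹' Set.Iio a) μ := by
    intro a
    have : P.value t ⁻¹' Set.Iio a = {x | ∃ c, (x, c) ∈ codesBelow P t fun _ => a} :=
      Set.ext fun x => value_lt_iff t (fun _ => a) x
    rw [this]
    exact nullMeasurableSet_projection μ (measurableSet_codesBelow t measurable_const)
  exact measurable_of_Iio (α := EReal) (δ := NullMeasurableSpace (E n) μ) h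

theorem aemeasurable_value_f (t s : ℕ) (x : E n) (u : E m) :
    AEMeasurable (fun w => P.value t (P.f x u w)) (P.ν s) := by
  have hf : Measurable fun w => P.f x u w :=
    P.measurable_f.comp (by fun_prop : Measurable fun w : E l => (x, u, w))
  have := Measure.isProbabilityMeasure_map (μ := P.ν s) hf.aemeasurable
  exact (aemeasurable_value t _).comp_measurable hf

/-- One strategy is near-optimal from almost every initial state. -/
theorem exists_strategy_expectedCost_lt (t : ℕ) (μ : Measure (E n)) [IsFiniteMeasure μ]
    {θ : E n → EReal} (hθ : Measurable θ) :
    ∃ π : P.Strategy, ∀ᵐ x ∂μ, P.value t x < θ x →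
      Feasible π t x ∧ expectedCost π t x < θ x := by
  obtain ⟨s, hs, hsB⟩ := exists_measurable_uniformization μ (measurableSet_codesBelow (P := P) t hθ)
  refine ⟨Strategy.select codedStrategy measurableFamily_codedStrategy s hs, ?_⟩
  filter_upwards [hsB] with x hx hvx
  obtain ⟨h1, h2⟩ := hx ((value_lt_iff t θ x).1 hvx)
  constructor
  · rw [Feasible, pathLaw_select]; exact h1
  · rw [expectedCost, pathLaw_select]; exact h2

/-! ### The Bellman equation -/

theorem coe_add_expectation_cost_eq (π : P.Strategy) (t : ℕ) (x : E n) (u : E m) (w : E l) (k : ℕ)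
    (h : ∫⁻ ω, ENNReal.ofReal (P.cost (ω.prepend x u w)) ∂pathLaw π t (P.f x u w) k ≠ ⊤) :
    (P.r x u : EReal) +
        expectation (pathLaw π t (P.f x u w) k) (fun ω => (P.cost ω : EReal)) =
      ((∫⁻ ω, ENNReal.ofReal (P.cost (ω.prepend x u w)) ∂pathLaw π t (P.f x u w) k : ℝ≥0∞)
        : EReal) -
      ((∫⁻ ω, ENNReal.ofReal (-P.cost (ω.prepend x u w)) ∂pathLaw π t (P.f x u w) k : ℝ≥0∞)
        : EReal) := by
  rw [← expectation_const_add measurable_cost.coe_real_ereal.aemeasurable,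
    expectation_of_ne_top]
  · simp only [cost_prepend, ← EReal.coe_add, ← EReal.coe_neg, toENNReal_coe_real]
  · simpa only [cost_prepend, ← EReal.coe_add, toENNReal_coe_real] using h

/-- A lower bound for the expected cost: it is an average, over the first control, of quantities
that dominate the right hand side of the Bellman equation, because every continuation of a feasible
strategy is almost surely feasible for the state that is reached. -/
theorem le_expectedCost_of_forall_le {t : ℕ} (ht : t < P.T) {x : E n} {π : P.Strategy}
    (hπ : Feasible π t x) {R : EReal}
    (hR : ∀ u ∈ P.U, P.stageRisk t x u ≤ (P.δ : EReal) →
      R ≤ (P.r x u : EReal) + expectation (P.ν t) (fun w => P.value (t + 1) (P.f x u w))) :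
    R ≤ expectedCost π t x := by
  obtain ⟨k, hk⟩ : ∃ k, P.T - (t + 1) = k := ⟨_, rfl⟩
  have hk' : P.T - t = k + 1 := by omega
  rw [feasible_iff, hk', isSafe_succ_iff] at hπ
  rw [expectedCost, hk']
  by_cases htop : ∫⁻ ω, ENNReal.ofReal (P.cost ω) ∂pathLaw π t x (k + 1) = ⊤
  · rw [expectation_of_eq_top (by simpa only [toENNReal_coe_real] using htop)]
    exact le_top
  have hgp : Measurable fun ω : Path n m l (k + 1) => ENNReal.ofReal (P.cost ω) :=
    measurable_cost.ennreal_ofReal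
  have hgn : Measurable fun ω : Path n m l (k + 1) => ENNReal.ofReal (-P.cost ω) :=
    measurable_cost.neg.ennreal_ofReal
  rw [expectation_of_ne_top (by simpa only [toENNReal_coe_real] using htop)]
  simp only [← EReal.coe_neg, toENNReal_coe_real]
  have hap := measurable_lintegral_prepend π t x k hgp
  have hbp := measurable_lintegral_prepend π t x k hgn
  rw [lintegral_pathLaw_succ' π t x k hgp] at htop ⊢
  rw [lintegral_pathLaw_succ' π t x k hgn]
  have hAm := Measurable.lintegral_prod_right' (ν := P.ν t) hap
  have hU : ∀ᵐ u ∂π.kernel 0 (initialHistory x), u ∈ P.U :=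
    (prob_compl_eq_zero_iff P.measurableSet_U).2 (π.mem_U 0 _)
  rw [← expectation_const (π.kernel 0 (initialHistory x)) R]
  refine expectation_le_of_ae_le aemeasurable_const hAm.aemeasurable htop ?_
  filter_upwards [hU, hπ.1, hπ.2, ae_lt_top hAm htop] with u huU hu hsafe hAu
  refine (hR u huU hu).trans ?_
  have hvm := aemeasurable_value_f (P := P) (t + 1) t x u
  rw [← expectation_const_add hvm]
  refine expectation_le_of_ae_le (hvm.const_add _)
    (hap.comp (measurable_prodMk_left (x := u))).aemeasurable hAu.ne ?_
  filter_upwards [hsafe, ae_lt_top (hap.comp (measurable_prodMk_left (x := u))) hAu.ne]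
    with w hw haw
  refine le_trans ?_ (coe_add_expectation_cost_eq _ _ _ _ _ _ haw.ne).le
  gcongr
  have hfe : Feasible (π.tail x w) (t + 1) (P.f x u w) := by
    rw [feasible_iff, hk]; exact hw
  refine (iInf₂_le (π.tail x w) hfe).trans (le_of_eq ?_)
  rw [expectedCost, hk]

/-- The strategy that starts with the control `u` and then follows `π`. -/
noncomputable def Strategy.cons (u : E m) (hu : u ∈ P.U) (π : P.Strategy) : P.Strategy where
  kernel k := match k with
    | 0 => Kernel.const _ (Measure.dirac u)
    | k + 1 => (π.kernel k).comap (fun h => (Fin.tail h.1, h.2)) (by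
        unfold Fin.tail
        fun_prop)
  isMarkovKernel k := by
    cases k <;> infer_instance
  mem_U k h := by
    cases k with
    | zero => simp [Measure.dirac_apply' _ P.measurableSet_U, hu]
    | succ k => exact π.mem_U k _

theorem Strategy.tail_cons (u : E m) (hu : u ∈ P.U) (π : P.Strategy) (x : E n) (w : E l) :
    (Strategy.cons u hu π).tail x w = π := by
  have h : ((Strategy.cons u hu π).tail x w).kernel = π.kernel := by
    funext k
    ext h : 1
    rw [Strategy.kernel_tail_apply]
    change π.kernel k (Fin.tail (h.prepend x w).1, (h.prepend x w).2) = _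
    simp [History.prepend]
  cases π
  simp only [Strategy.tail] at h ⊢
  congr

/-- An upper bound for the value from the strategy that starts with the control `u` and goes on
with `π'`. This is where the costs of all safe strategies have to be well defined: otherwise the
costs after the first step need not average to the cost of the whole strategy. -/
theorem value_le_of_continuation (hP : P.CostsWellDefined) {t : ℕ} (ht : t < P.T) (x : E n)
    {u : E m} (hu : u ∈ P.U) (hrisk : P.stageRisk t x u ≤ (P.δ : EReal)) (π' : P.Strategy)
    {θ : E l → EReal} (hθ : Measurable θ) (hθint : ∫⁻ w, (θ w).toENNReal ∂P.ν t ≠ ⊤)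
    (hgood : ∀ᵐ w ∂P.ν t, Feasible π' (t + 1) (P.f x u w) ∧
      expectedCost π' (t + 1) (P.f x u w) ≤ θ w) :
    P.value t x ≤ (P.r x u : EReal) + expectation (P.ν t) θ := by
  obtain ⟨k, hk⟩ : ∃ k, P.T - (t + 1) = k := ⟨_, rfl⟩
  have hk' : P.T - t = k + 1 := by omega
  let π := Strategy.cons u hu π'
  have hker : π.kernel 0 (initialHistory x) = Measure.dirac u := rfl
  have hsafe : Feasible π t x := by
    rw [feasible_iff, hk', isSafe_succ_iff, hker]
    have hms : MeasurableSet {u | P.stageRisk t x u ≤ (P.δ : EReal)} :=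
      measurableSet_le (((measurable_stageRisk (P := P) t).comp
        (measurable_prodMk_left (x := x))) :) measurable_const
    refine ⟨(ae_dirac_iff hms).2 hrisk, ?_⟩
    rw [ae_dirac_eq, Filter.eventually_pure]
    filter_upwards [hgood] with w hw
    rw [Strategy.tail_cons]
    have := hw.1
    rwa [feasible_iff, hk] at this
  refine (iInf₂_le π hsafe).trans ?_
  have hwd := hP t ht.le x π hsafe
  rw [hk'] at hwd
  rw [expectedCost, hk', ← expectation_const_add hθ.aemeasurable]
  have hmap : ∀ (w : E l) (F : Path n m l (k + 1) → ℝ≥0∞), Measurable F →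
      ∫⁻ y, F y ∂(pathLaw π' (t + 1) (P.f x u w) k).map (Path.prepend x u w) =
        ∫⁻ ω, F (ω.prepend x u w) ∂pathLaw (π.tail x w) (t + 1) (P.f x u w) k := by
    intro w F hF
    rw [lintegral_map hF (Path.measurable_prepend_right x u w), Strategy.tail_cons]
  refine expectation_le_expectation_of_mixture
    (κ := fun w => (pathLaw π' (t + 1) (P.f x u w) k).map (Path.prepend x u w))
    (fun F hF => ?_) (fun F hF => ?_) measurable_cost hwd (hθ.const_add _).aemeasurable ?_ ?_
  · have hm := Measurable.lintegral_prod_right' (ν := P.ν t)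
      (measurable_lintegral_prepend π t x k hF)
    rw [lintegral_pathLaw_succ' π t x k hF, hker]
    exact (lintegral_dirac' u hm).trans (lintegral_congr fun w => (hmap w F hF).symm)
  · simp only [hmap _ F hF]
    exact ((measurable_lintegral_prepend π t x k hF).comp
      (measurable_prodMk_left (x := u))).aemeasurable
  · refine lintegral_toENNReal_ne_top_of_ae_le
      (a := fun w => (θ w).toENNReal + ENNReal.ofReal (P.r x u))
      (b := fun w => (-θ w).toENNReal + ENNReal.ofReal (-P.r x u)) ?_ ?_
    · rw [lintegral_add_right _ measurable_const]
      simp [hθint]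
    · filter_upwards [ae_lt_top hθ.ereal_toENNReal hθint] with w hw
      rw [← ereal_coe_add_sub _ hw.ne, ← ereal_eq_toENNReal_sub]
  · filter_upwards [hgood] with w hw
    have h1 := hw.2
    rw [expectedCost, hk] at h1
    refine le_trans (le_of_eq ?_) (add_le_add_right h1 _)
    rw [← expectation_const_add measurable_cost.coe_real_ereal.aemeasurable,
      expectation_map _ (Path.measurable_prepend_right x u w) measurable_cost.coe_real_ereal]
    simp only [cost_prepend, EReal.coe_add]

/-- Near-optimal continuations after the first control `u`, measurably chosen, show that the right
hand side of the Bellman equation bounds the value from above. -/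
theorem value_le_of_stageRisk_le (hP : P.CostsWellDefined) {t : ℕ} (ht : t < P.T) (x : E n)
    {u : E m} (hu : u ∈ P.U) (hrisk : P.stageRisk t x u ≤ (P.δ : EReal)) :
    P.value t x ≤
      (P.r x u : EReal) + expectation (P.ν t) (fun w => P.value (t + 1) (P.f x u w)) := by
  have hf : Measurable fun w => P.f x u w :=
    P.measurable_f.comp (by fun_prop : Measurable fun w : E l => (x, u, w))
  have hμ := Measure.isProbabilityMeasure_map (μ := P.ν t) hf.aemeasurable
  have hv := aemeasurable_value (P := P) (t + 1) ((P.ν t).map fun w => P.f x u w)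
  have hvm := hv.comp_measurable hf
  set v : E l → EReal := fun w => P.value (t + 1) (P.f x u w) with hvdef
  by_cases htop : ∫⁻ w, (v w).toENNReal ∂P.ν t = ⊤
  · rw [expectation_of_eq_top htop]; simp
  -- a Borel version of the value function, and Borel functions strictly above it
  set v' := hv.mk _ with hv'
  have hv'm : Measurable v' := hv.measurable_mk
  have hvv' : ∀ᵐ w ∂P.ν t, v w = v' (P.f x u w) := ae_of_ae_map hf.aemeasurable hv.ae_eq_mk
  let ε : ℕ → ℝ≥0∞ := fun N => (N + 1 : ℝ≥0∞)⁻¹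
  have hε0 : ∀ N, ε N ≠ 0 := fun N => ENNReal.inv_ne_zero.2 (by finiteness)
  have hεtop : ∀ N, ε N ≠ ⊤ := fun N => ENNReal.inv_ne_top.2 (by simp)
  let p : ℕ → E n → ℝ≥0∞ := fun N y => (v' y).toENNReal + ε N
  let b : ℕ → E n → ℝ≥0∞ := fun N y => min (-v' y).toENNReal N
  have hpm : ∀ N, Measurable (p N) := fun N => hv'm.ereal_toENNReal.add_const _
  have hbm : ∀ N, Measurable (b N) := fun N =>
    (continuous_neg.measurable.comp hv'm).ereal_toENNReal.min measurable_const
  let θ : ℕ → E n → EReal := fun N y => (p N y : EReal) - (b N y : EReal)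
  have hθm : ∀ N, Measurable (θ N) := fun N => by
    simp only [θ, sub_eq_add_neg]
    exact (hpm N).coe_ereal_ennreal.add (continuous_neg.measurable.comp (hbm N).coe_ereal_ennreal)
  have hpint : ∀ N, ∫⁻ w, p N (P.f x u w) ∂P.ν t = ∫⁻ w, (v w).toENNReal ∂P.ν t + ε N := by
    intro N
    have : ∫⁻ w, (v w).toENNReal ∂P.ν t = ∫⁻ w, (v' (P.f x u w)).toENNReal ∂P.ν t :=
      lintegral_congr_ae (by filter_upwards [hvv'] with w hw; rw [hw])
    rw [this]
    simp only [p]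
    rw [lintegral_add_right _ measurable_const]
    simp
  have hθlt : ∀ N y, v' y ≠ ⊤ → v' y < θ N y := by
    intro N y hy
    have hbt : b N y ≠ ⊤ := ne_top_of_le_ne_top (ENNReal.natCast_ne_top N) (min_le_right _ _)
    have hpt : (v' y).toENNReal ≠ ⊤ := by simpa using hy
    have h1 : v' y ≤ ((v' y).toENNReal : EReal) - (b N y : EReal) := by
      conv_lhs => rw [ereal_eq_toENNReal_sub (v' y)]
      exact ereal_coe_sub_le_coe_sub (add_le_add_right (min_le_left _ _) _) hpt hpt
    refine lt_of_le_of_lt h1 ?_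
    simp only [θ, p]
    generalize (v' y).toENNReal = a at hpt
    generalize b N y = d at hbt
    have h0 := hε0 N
    have h0t := hεtop N
    generalize ε N = e at h0 h0t
    lift a to NNReal using hpt
    lift d to NNReal using hbt
    lift e to NNReal using h0t
    rw [← ENNReal.coe_add, ereal_coe_sub_coe, ereal_coe_sub_coe, EReal.coe_lt_coe_iff]
    have : (0 : ℝ) < e := NNReal.coe_pos.2 (pos_iff_ne_zero.2 (by simpa using h0))
    push_cast
    linarith
  -- the near-optimal continuations give upper bounds for the value
  have hbound : ∀ N, P.value t x ≤ (P.r x u : EReal) +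
      (((∫⁻ w, (v w).toENNReal ∂P.ν t + ε N : ℝ≥0∞) : EReal) -
        ((∫⁻ w, b N (P.f x u w) ∂P.ν t : ℝ≥0∞) : EReal)) := by
    intro N
    obtain ⟨π', hπ'⟩ := exists_strategy_expectedCost_lt (P := P) (t + 1)
      ((P.ν t).map fun w => P.f x u w) (hθm N)
    have hgood : ∀ᵐ w ∂P.ν t, Feasible π' (t + 1) (P.f x u w) ∧
        expectedCost π' (t + 1) (P.f x u w) < θ N (P.f x u w) := by
      filter_upwards [ae_of_ae_map hf.aemeasurable hπ', hvv',
        ae_ne_top_of_lintegral_ne_top hvm htop] with w h1 h2 h3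
      refine h1 ?_
      change v w < _
      rw [h2]
      exact hθlt N _ (by rw [← h2]; exact h3)
    have hθf : Measurable fun w => θ N (P.f x u w) := (hθm N).comp hf
    have hpne : ∫⁻ w, p N (P.f x u w) ∂P.ν t ≠ ⊤ := by
      rw [hpint N]
      exact ENNReal.add_ne_top.2 ⟨htop, hεtop N⟩
    refine (value_le_of_continuation hP ht x hu hrisk π' hθf
      (lintegral_toENNReal_ne_top_of_ae_le hpne (Filter.Eventually.of_forall fun w => le_rfl))
      (by filter_upwards [hgood] with w hw using ⟨hw.1, hw.2.le⟩)).trans ?_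
    rw [← hpint N]
    exact add_le_add_right (expectation_le_of_ae_le hθf.aemeasurable
      ((hpm N).comp hf).aemeasurable hpne (Filter.Eventually.of_forall fun w => le_rfl)) _
  -- let the accuracy increase
  rw [expectation_of_ne_top htop]
  have hblim : Filter.Tendsto (fun N => ∫⁻ w, b N (P.f x u w) ∂P.ν t) Filter.atTop
      (nhds (∫⁻ w, (-v w).toENNReal ∂P.ν t)) := by
    have h1 : ∫⁻ w, (-v w).toENNReal ∂P.ν t = ∫⁻ w, (-v' (P.f x u w)).toENNReal ∂P.ν t :=
      lintegral_congr_ae (by filter_upwards [hvv'] with w hw; rw [hw])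
    rw [h1]
    refine lintegral_tendsto_of_tendsto_of_monotone (fun N => ((hbm N).comp hf).aemeasurable)
      (Filter.Eventually.of_forall fun w N N' hN => min_le_min le_rfl (by exact_mod_cast hN))
      (Filter.Eventually.of_forall fun w => ?_)
    have := (tendsto_const_nhds (x := (-v' (P.f x u w)).toENNReal)).min
      ENNReal.tendsto_nat_nhds_top
    simpa using this
  have hεlim : Filter.Tendsto (fun N => ∫⁻ w, (v w).toENNReal ∂P.ν t + ε N) Filter.atTop
      (nhds (∫⁻ w, (v w).toENNReal ∂P.ν t)) := by
    have h1 : Filter.Tendsto ε Filter.atTop (nhds 0) := by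
      have := (ENNReal.tendsto_inv_nat_nhds_zero).comp (Filter.tendsto_add_atTop_nat 1)
      simpa [ε, Function.comp_def] using this
    simpa using h1.const_add (∫⁻ w, (v w).toENNReal ∂P.ν t)
  have hp' := (continuous_coe_ennreal_ereal.tendsto _).comp hεlim
  have hb' := ((continuous_neg.comp continuous_coe_ennreal_ereal).tendsto _).comp hblim
  have hAne : ((∫⁻ w, (v w).toENNReal ∂P.ν t : ℝ≥0∞) : EReal) ≠ ⊤ := by simpa using htop
  have hdiff := (EReal.continuousAt_add (p := (_, _)) (Or.inl hAne)
    (Or.inl (EReal.coe_ennreal_ne_bot _))).tendsto.comp (hp'.prodMk_nhds hb')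
  have hsum := (EReal.continuousAt_add (p := ((P.r x u : EReal), _))
    (Or.inl (EReal.coe_ne_top _)) (Or.inl (EReal.coe_ne_bot _))).tendsto.comp
    ((tendsto_const_nhds (x := (P.r x u : EReal))).prodMk_nhds hdiff)
  exact ge_of_tendsto' hsum hbound

theorem value_horizon (x : E n) : P.value P.T x = (P.q x : EReal) := by
  have hcost : ∀ π : P.Strategy, expectedCost π P.T x = (P.q x : EReal) := by
    intro π
    have h0 : P.T - P.T = 0 := Nat.sub_self _
    rw [expectedCost, h0, pathLaw, expectation_dirac _ measurable_cost.coe_real_ereal]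
    simp [cost, Path.state, Fin.snoc]
  have hfeas : ∀ π : P.Strategy, Feasible π P.T x := fun π i =>
    (Nat.not_lt_zero _ (lt_of_lt_of_eq i.2 (Nat.sub_self _))).elim
  have : Nonempty P.Strategy := ⟨codedStrategy fun _ _ => 0⟩
  simp only [value, hcost, hfeas, iInf_const]

end Problem

end SafetyControl

theorem theorem1 {n m l : ℕ} (P : SafetyControl.Problem n m l) (hP : P.CostsWellDefined) :
    (∀ x, P.value P.T x = (P.q x : EReal)) ∧
    ∀ t < P.T, ∀ x,
      (∀ u ∈ P.U, AEMeasurable (fun w => P.value (t + 1) (P.f x u w)) (P.ν t)) ∧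
      P.value t x =
        ⨅ (u : SafetyControl.E m) (_ : u ∈ P.U) (z : ℝ)
          (_ : SafetyControl.expectation (P.ν t) (fun w =>
            ((z + max (Metric.infDist (P.f x u w) P.A - z) 0 / (1 - P.α) : ℝ) : EReal))
              ≤ (P.δ : EReal)),
          (P.r x u : EReal) +
            SafetyControl.expectation (P.ν t) (fun w => P.value (t + 1) (P.f x u w)) := by
  refine ⟨SafetyControl.Problem.value_horizon, fun t ht x =>
    ⟨fun u _ => SafetyControl.Problem.aemeasurable_value_f (t + 1) t x u, le_antisymm ?_ ?_⟩⟩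
  · exact le_iInf₂ fun u hu => le_iInf₂ fun z hz =>
      SafetyControl.Problem.value_le_of_stageRisk_le hP ht x hu
        ((SafetyControl.Problem.stageRisk_le_iff t x u).2 ⟨z, hz⟩)
  · refine le_iInf₂ fun π hπ =>
      SafetyControl.Problem.le_expectedCost_of_forall_le ht hπ fun u hu hrisk => ?_
    obtain ⟨z, hz⟩ := (SafetyControl.Problem.stageRisk_le_iff t x u).1 hrisk
    exact (iInf₂_le u hu).trans (iInf₂_le z hz)
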